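/- Let $1\le r\le n$, let $\Sigma^n$ be a smooth $n$-dimensional Riemannian manifold, $X\colon\Sigma^n\to\mathbb{R}^{n+1}$ a smooth isometric immersion, and $N$ a continuous globally defined unit normal vector field along $X$. Let $A$, $A(v)=-\overline\nabla_vN$, be the shape operator, $\overline\nabla$ being the flat connection of $\mathbb{R}^{n+1}$; its eigenvalues $k_1,\dots,k_n$ are the principal curvatures. Put $\sigma_0=1$, $\sigma_j=\sum_{i_1<\dots<i_j}k_{i_1}\cdots k_{i_j}$, and let $P_{r-1}=\sum_{j=0}^{r-1}(-1)^j\sigma_{r-1-j}A^j$ be the $(r-1)$-th Newton transformation. Put $$\|\sqrt{P_{r-1}}A\|^2:=\operatorname{tr}(P_{r-1}A^2).$$ For a smooth function $f$ on $\Sigma^n$ let $\nabla f$ be its gradient, $\operatorname{Hess}f(v)=\nabla_v\nabla f$ its Hessian operator ($\nabla$ the Levi-Civita connection of $\Sigma^n$), and $$\mathcal{L}_{r-1}f=\operatorname{tr}(P_{r-1}\operatorname{Hess}f)-\langle X,\nabla f\rangle .$$ Suppose that $\Sigma^n$ is a self-shrinker of the $r$-mean curvature flow in the sense that $\sigma_r=-\langle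 X,N\rangle$ on $\Sigma^n$. Then: 1. $N$ and $\sigma_r$ are smooth. 2. At each point at which $P_{r-1}$ is positive semidefinite it has a unique symmetric positive semidefinite square root. Moreover, at every point, if $S$ is a symmetric positive semidefinite operator with $S^2=P_{r-1}$, then $\operatorname{tr}\big((SA)^t(SA)\big)=\operatorname{tr}(P_{r-1}A^2)$; so there $\|\sqrt{P_{r-1}}A\|^2$ is indeed the squared trace norm of $\sqrt{P_{r-1}}A$. 3. On $\Sigma^n$, $$\mathcal{L}_{r-1}\sigma_r+\big[\|\sqrt{P_{r-1}}A\|^2-r\big]\sigma_r=0 .$$ 4. On $\Sigma^n$, $$\tfrac12\mathcal{L}_{r-1}\sigma_r^2=\sigma_r^2\big[r-\|\sqrt{P_{r-1}}A\|^2\big]+\langle P_{r-1}(\nabla\sigma_r),\nabla\sigma_r\rangle .$$ 5. At each point at which $P_{r-1}$ is positive semidefinite and $\|\sqrt{P_{r-1}}A\|^2\le r$, one has $\tfrac12\mathcal{L}_{r-1}\sigma_r^2\ge0$. -/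

import Mathlib

open Bundle Manifold
open scoped ContDiff

noncomputable section

namespace SelfShrinker

/-! ### Algebra of a shape operator on a finite-dimensional inner product space -/

section Algebra

variable {V : Type*} [NormedAddCommGroup V] [InnerProductSpace ℝ V] [FiniteDimensional ℝ V]

/-- The real eigenvalues of `A`, repeated according to multiplicity. For the (symmetric) shape
operator of a hypersurface these are all its principal curvatures. -/
def principalCurvatures (A : V →ₗ[ℝ] V) : Multiset ℝ := A.charpoly.roots

/-- `σ_r`, the `r`-th elementary symmetric function of the principal curvatures
(`σ_0 = 1`, and `σ_r = 0` for `r > dim V`). -/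
def sigma (A : V →ₗ[ℝ] V) (r : ℕ) : ℝ := (principalCurvatures A).esymm r

/-- The Newton transformation `P_r = ∑_{j ≤ r} (-1)^j σ_{r-j} A^j`. -/
def newton (A : V →ₗ[ℝ] V) (r : ℕ) : V →ₗ[ℝ] V :=
  ∑ j ∈ Finset.range (r + 1), ((-1) ^ j * sigma A (r - j)) • A ^ j

/-- The squared trace norm `‖T‖² = tr (Tᵗ T)`. -/
def traceNormSq (T : V →ₗ[ℝ] V) : ℝ := LinearMap.trace ℝ V (T.adjoint ∘ₗ T)

/-- `S` is the square root `√P` of `P`: it is symmetric positive semidefinite with `S² = P`. -/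
def IsSqrt (S P : V →ₗ[ℝ] V) : Prop := S.IsPositive ∧ S ∘ₗ S = P

/-- `tr (P_r A²)`, the quantity denoted by `‖√P_r A‖²`. -/
def modifiedNormSq (A : V →ₗ[ℝ] V) (r : ℕ) : ℝ := LinearMap.trace ℝ V (newton A r ∘ₗ A ∘ₗ A)

end Algebra

/-! Derivatives of vector-valued functions, read in the chart at the point. -/

section Calculus

variable {n : ℕ} {M : Type*} [TopologicalSpace M] [ChartedSpace (EuclideanSpace ℝ (Fin n)) M]

theorem mvfderiv_eq_fderiv {F : Type*} [NormedAddCommGroup F] [NormedSpace ℝ F] {f : M → F}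
    {x : M} (hf : MDifferentiableAt (𝓡 n) 𝓘(ℝ, F) f x) (v : TangentSpace (𝓡 n) x) :
    mvfderiv (𝓡 n) f x v =
      fderiv ℝ (f ∘ (extChartAt (𝓡 n) x).symm) (extChartAt (𝓡 n) x x) v := by
  rw [hf.mvfderiv]
  simp [writtenInExtChartAt, fderivWithin_univ]
  rfl

theorem differentiableAt_comp_symm {F : Type*} [NormedAddCommGroup F] [NormedSpace ℝ F] {f : M → F}
    {x : M} (hf : MDifferentiableAt (𝓡 n) 𝓘(ℝ, F) f x) :
    DifferentiableAt ℝ (f ∘ (extChartAt (𝓡 n) x).symm) (extChartAt (𝓡 n) x x) := by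
  have h := (mdifferentiableWithinAt_univ.2 hf).differentiableWithinAt_comp_extChartAt_symm
  rw [Set.preimage_univ, Set.univ_inter, ModelWithCorners.range_eq_univ,
    differentiableWithinAt_univ] at h
  exact h

theorem mvfderiv_inner {F : Type*} [NormedAddCommGroup F] [InnerProductSpace ℝ F] {f g : M → F}
    {x : M} (hf : MDifferentiableAt (𝓡 n) 𝓘(ℝ, F) f x) (hg : MDifferentiableAt (𝓡 n) 𝓘(ℝ, F) g x)
    (v : TangentSpace (𝓡 n) x) :
    mvfderiv (𝓡 n) (fun y ↦ (inner ℝ (f y) (g y) : ℝ)) x v =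
      inner ℝ (f x) (mvfderiv (𝓡 n) g x v) + inner ℝ (mvfderiv (𝓡 n) f x v) (g x) := by
  have h : MDifferentiableAt (𝓡 n) 𝓘(ℝ, ℝ) (fun y ↦ (inner ℝ (f y) (g y) : ℝ)) x := by
    have hb : DifferentiableAt ℝ (fun p : F × F ↦ (inner ℝ p.1 p.2 : ℝ)) (f x, g x) :=
      differentiableAt_fst.inner ℝ differentiableAt_snd
    exact DifferentiableAt.comp_mdifferentiableAt (f := fun y ↦ (f y, g y)) hb (hf.prodMk_space hg)
  rw [mvfderiv_eq_fderiv h, mvfderiv_eq_fderiv hf, mvfderiv_eq_fderiv hg]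
  have := fderiv_inner_apply ℝ (differentiableAt_comp_symm hf) (differentiableAt_comp_symm hg) v
  simpa [Function.comp_def] using this

end Calculus

/-! ### Isometrically immersed hypersurfaces of Euclidean space -/

instance finiteDimensional_tangentSpace {n : ℕ} {M : Type*} [TopologicalSpace M]
    [ChartedSpace (EuclideanSpace ℝ (Fin n)) M] (x : M) :
    FiniteDimensional ℝ (TangentSpace (𝓡 n) x) :=
  inferInstanceAs (FiniteDimensional ℝ (EuclideanSpace ℝ (Fin n)))

variable {n : ℕ} {M : Type*} [TopologicalSpace M] [ChartedSpace (EuclideanSpace ℝ (Fin n)) M]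
  [RiemannianBundle (fun x : M ↦ TangentSpace (𝓡 n) x)]

instance completeSpace_tangentSpace (x : M) : CompleteSpace (TangentSpace (𝓡 n) x) :=
  FiniteDimensional.complete ℝ _

/-- `X` is a smooth isometric immersion of the Riemannian manifold `M` in Euclidean space. -/
structure IsIsometricImmersion (X : M → EuclideanSpace ℝ (Fin (n + 1))) : Prop where
  contMDiff : ContMDiff (𝓡 n) (𝓡 (n + 1)) ∞ X
  inner_mvfderiv (x : M) (u v : TangentSpace (𝓡 n) x) :
    inner ℝ (mvfderiv (𝓡 n) X x u) (mvfderiv (𝓡 n) X x v) = inner ℝ u v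

/-- `N` is a continuous unit normal field along `X`. -/
structure IsUnitNormal (X N : M → EuclideanSpace ℝ (Fin (n + 1))) : Prop where
  continuous : Continuous N
  norm_eq_one (x : M) : ‖N x‖ = 1
  inner_mvfderiv (x : M) (v : TangentSpace (𝓡 n) x) : inner ℝ (N x) (mvfderiv (𝓡 n) X x v) = 0

/-- The tangential part of a vector `w` of Euclidean space at `x`: the tangent vector `w^⊤` with
`⟨w^⊤, v⟩ = ⟨w, dX v⟩` for every `v`. For an isometric immersion `dX (w^⊤)` is the orthogonal
projection of `w` to the image of `dX`. -/
def tangentialPart (X : M → EuclideanSpace ℝ (Fin (n + 1))) (x : M) :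
    EuclideanSpace ℝ (Fin (n + 1)) →L[ℝ] TangentSpace (𝓡 n) x :=
  (mvfderiv (𝓡 n) X x).adjoint

theorem IsIsometricImmersion.tangentialPart_mvfderiv
    {X : M → EuclideanSpace ℝ (Fin (n + 1))} (hX : IsIsometricImmersion X) (x : M)
    (v : TangentSpace (𝓡 n) x) : tangentialPart X x (mvfderiv (𝓡 n) X x v) = v := by
  refine ext_inner_right ℝ fun u ↦ ?_
  rw [tangentialPart, ContinuousLinearMap.adjoint_inner_left, hX.inner_mvfderiv]

/-- The Levi-Civita connection of the induced metric, `∇_v Y = (D_v (dX Y))^⊤`. -/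
def connection (X : M → EuclideanSpace ℝ (Fin (n + 1))) (Y : Π x : M, TangentSpace (𝓡 n) x)
    (x : M) : TangentSpace (𝓡 n) x →L[ℝ] TangentSpace (𝓡 n) x :=
  tangentialPart X x ∘L mvfderiv (𝓡 n) (fun y ↦ mvfderiv (𝓡 n) X y (Y y)) x

/-! The next facts justify the name `connection`: for an isometric immersion it is a covariant
derivative on the tangent bundle which is compatible with the metric and torsion-free. -/

section LeviCivita

variable [IsManifold (𝓡 n) ∞ M] {X : M → EuclideanSpace ℝ (Fin (n + 1))}

theorem IsIsometricImmersion.mdifferentiableAt_push (hX : IsIsometricImmersion X)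
    {Y : Π x : M, TangentSpace (𝓡 n) x} {x : M}
    (hY : MDifferentiableAt (𝓡 n) (𝓡 n).tangent (fun y ↦ (Y y : TangentBundle (𝓡 n) M)) x) :
    MDifferentiableAt (𝓡 n) (𝓡 (n + 1)) (fun y ↦ mvfderiv (𝓡 n) X y (Y y)) x := by
  have h1 := (hX.contMDiff.contMDiff_tangentMap (m := 1)
    (by norm_num; exact ENat.LEInfty.out)).mdifferentiable (by norm_num)
  have h2 := (h1 _).comp x hY
  have h3 := (contMDiff_snd_tangentBundle_modelSpace (EuclideanSpace ℝ (Fin (n + 1))) (𝓡 (n + 1))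
    (n := 1)).mdifferentiable (by norm_num)
  exact (h3 _).comp x h2

theorem IsIsometricImmersion.isCovariantDerivativeOn_connection (hX : IsIsometricImmersion X) :
    IsCovariantDerivativeOn (EuclideanSpace ℝ (Fin n)) (connection (M := M) X) where
  add {σ σ' x} hσ hσ' _ := by
    have := mvfderiv_add (hX.mdifferentiableAt_push hσ) (hX.mdifferentiableAt_push hσ')
    simp only [connection, ← ContinuousLinearMap.comp_add, ← this]
    congr 2
    ext1 y
    simp
  leibniz {σ g x} hσ hg _ := by
    have := mvfderiv_smul hg (hX.mdifferentiableAt_push hσ)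
    have e : (fun y ↦ mvfderiv (𝓡 n) X y ((g • σ) y)) = g • (fun y ↦ mvfderiv (𝓡 n) X y (σ y)) := by
      ext1 y; simp
    rw [connection, e, this]
    ext1 v
    simp [connection, hX.tangentialPart_mvfderiv]

/-- `connection X` as a bundled covariant derivative. -/
def IsIsometricImmersion.leviCivita (hX : IsIsometricImmersion X) :
    CovariantDerivative (𝓡 n) (EuclideanSpace ℝ (Fin n)) (TangentSpace (𝓡 n) : M → Type _) :=
  ⟨connection X, hX.isCovariantDerivativeOn_connection⟩

theorem IsIsometricImmersion.isMetricCompatible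
    [IsContMDiffRiemannianBundle (𝓡 n) 1 (EuclideanSpace ℝ (Fin n))
      (fun x : M ↦ TangentSpace (𝓡 n) x)] (hX : IsIsometricImmersion X) :
    hX.leviCivita.IsMetricCompatible := by
  rw [CovariantDerivative.isMetricCompatible_iff]
  intro x Z σ τ hZ hσ hτ
  simp only [← hX.inner_mvfderiv]
  rw [mvfderiv_inner (hX.mdifferentiableAt_push hσ) (hX.mdifferentiableAt_push hτ)]
  simp only [hX.inner_mvfderiv]
  change _ = inner ℝ (tangentialPart X x _) _ + inner ℝ _ (tangentialPart X x _)
  simp only [tangentialPart, ContinuousLinearMap.adjoint_inner_left, ContinuousLinearMap.adjoint_inner_right]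
  exact add_comm _ _

open VectorField in
theorem IsIsometricImmersion.torsion_eq_zero (hX : IsIsometricImmersion X) :
    hX.leviCivita.torsion = 0 := by
  rw [CovariantDerivative.torsion_eq_zero_iff]
  intro Z Y x hZ hY
  set φ := extChartAt (𝓡 n) x with hφ
  set p := φ x with hp
  let hat (W : Π x : M, TangentSpace (𝓡 n) x) : EuclideanSpace ℝ (Fin n) → EuclideanSpace ℝ (Fin n) :=
    mpullbackWithin 𝓘(ℝ, EuclideanSpace ℝ (Fin n)) (𝓡 n) φ.symm W (Set.range (𝓡 n))
  have hatdiff (W : Π x : M, TangentSpace (𝓡 n) x) (hW : MDifferentiableAt (𝓡 n) (𝓡 n).tangent (fun y ↦ (W y : TangentBundle (𝓡 n) M)) x) : DifferentiableAt ℝ (hat W) p := by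
    have h : DifferentiableWithinAt ℝ (hat W) (φ.symm ⁻¹' Set.univ ∩ Set.range (𝓡 n)) p :=
      (mdifferentiableWithinAt_univ.2 hW).differentiableWithinAt_mpullbackWithin_vectorField
    have hs : φ.symm ⁻¹' Set.univ ∩ Set.range (𝓡 n) = Set.univ := by simp
    rw [hs] at h
    exact differentiableWithinAt_univ.1 h
  let G := X ∘ φ.symm
  have hG : ContDiffAt ℝ 2 G p := by
    have h := (contMDiffAt_iff.1 (hX.contMDiff x)).2
    rw [ModelWithCorners.range_eq_univ, contDiffWithinAt_univ] at h
    exact h.of_le (by norm_cast)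
  have key (W : Π x : M, TangentSpace (𝓡 n) x) :
     (fun y ↦ mvfderiv (𝓡 n) X y (W y)) ∘ φ.symm =ᶠ[nhds p] fun q ↦ fderiv ℝ G q (hat W q) := by
    filter_upwards [extChartAt_target_mem_nhds x] with q hq
    have hi := isInvertible_mfderivWithin_extChartAt_symm (I := 𝓡 n) hq
    have hd := mdifferentiableWithinAt_extChartAt_symm (I := 𝓡 n) hq
    have hc := mfderiv_comp_mfderivWithin q
      (hX.contMDiff.mdifferentiable (by norm_num) (φ.symm q)) hd
      ((𝓡 n).uniqueMDiffOn q (by simp))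
    have e : fderiv ℝ G q = mfderivWithin (𝓡 n) (𝓡 (n + 1)) (X ∘ φ.symm) (Set.range (𝓡 n)) q := by
      rw [ModelWithCorners.range_eq_univ, mfderivWithin_univ, mfderiv_eq_fderiv]
    rw [e, hc]
    change _ = mfderiv (𝓡 n) (𝓡 (n + 1)) X (φ.symm q) (mfderivWithin (𝓡 n) (𝓡 n) φ.symm (Set.range (𝓡 n)) q
      ((mfderivWithin (𝓡 n) (𝓡 n) φ.symm (Set.range (𝓡 n)) q).inverse (W (φ.symm q))))
    rw [hi.self_apply_inverse]
    rfl
  have hat0 (W : Π x : M, TangentSpace (𝓡 n) x) : hat W p = W x := by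
    have h : (W (φ.symm p) : EuclideanSpace ℝ (Fin n)) = W x :=
      congrArg (fun y ↦ (W y : EuclideanSpace ℝ (Fin n))) (extChartAt_to_inv x)
    exact (mfderivWithin_extChartAt_symm_inverse_apply (I := 𝓡 n) (x := x)
      (W (φ.symm p) : EuclideanSpace ℝ (Fin n))).trans h
  have hbr : mlieBracket (𝓡 n) Z Y x = lieBracket ℝ (hat Z) (hat Y) p := by
    have aux (L : EuclideanSpace ℝ (Fin n) →L[ℝ] EuclideanSpace ℝ (Fin n)) (hL : L = .id ℝ _)
        (s : Set (EuclideanSpace ℝ (Fin n))) (hs : s = Set.univ)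
        (V W : EuclideanSpace ℝ (Fin n) → EuclideanSpace ℝ (Fin n)) :
        L.inverse (lieBracketWithin ℝ V W s p) = lieBracket ℝ V W p := by
      rw [hL, hs, ContinuousLinearMap.inverse_id, lieBracketWithin_univ]
      rfl
    exact aux _ mfderiv_extChartAt_self _ (by simp) _ _
  have main (V W : Π x : M, TangentSpace (𝓡 n) x) (hV : MDifferentiableAt (𝓡 n) (𝓡 n).tangent (fun y ↦ (V y : TangentBundle (𝓡 n) M)) x) (hW : MDifferentiableAt (𝓡 n) (𝓡 n).tangent (fun y ↦ (W y : TangentBundle (𝓡 n) M)) x) :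
     mvfderiv (𝓡 n) (fun y ↦ mvfderiv (𝓡 n) X y (W y)) x (V x) =
      fderiv ℝ (fderiv ℝ G) p (hat V p) (hat W p) + fderiv ℝ G p (fderiv ℝ (hat W) p (hat V p)) := by
    rw [mvfderiv_eq_fderiv (hX.mdifferentiableAt_push hW), (key W).fderiv_eq]
    change fderiv ℝ (fun q ↦ fderiv ℝ G q (hat W q)) p (V x : EuclideanSpace ℝ (Fin n)) = _
    rw [← hat0 V]
    have h1 : DifferentiableAt ℝ (fderiv ℝ G) p :=
      (hG.fderiv_right (m := 1) (by norm_num)).differentiableAt (by norm_num)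
    have := fderiv_clm_apply h1 (hatdiff W hW)
    rw [this]
    simp [add_comm]
  change tangentialPart X x (mvfderiv (𝓡 n) (fun y ↦ mvfderiv (𝓡 n) X y (Y y)) x (Z x)) -
    tangentialPart X x (mvfderiv (𝓡 n) (fun y ↦ mvfderiv (𝓡 n) X y (Z y)) x (Y x)) = _
  rw [main _ _ hZ hY, main _ _ hY hZ, ← map_sub]
  have hsymm := (hG.isSymmSndFDerivAt (by simp)).eq (hat Z p) (hat Y p)
  rw [hsymm, add_sub_add_left_eq_sub, ← map_sub]
  refine Eq.trans ?_ hbr.symm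
  refine Eq.trans ?_ (hX.tangentialPart_mvfderiv x (lieBracket ℝ (hat Z) (hat Y) p))
  congr 1
  exact (mvfderiv_eq_fderiv (hX.contMDiff.mdifferentiable (by norm_num) x) _).symm

end LeviCivita

/-- The gradient `∇f`: `⟨∇f, v⟩ = df v`. -/
def grad (f : M → ℝ) (x : M) : TangentSpace (𝓡 n) x :=
  (InnerProductSpace.toDual ℝ (TangentSpace (𝓡 n) x)).symm (mvfderiv (𝓡 n) f x)

/-- The Hessian operator `v ↦ ∇_v ∇f`. -/
def hess (X : M → EuclideanSpace ℝ (Fin (n + 1))) (f : M → ℝ) (x : M) :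
    TangentSpace (𝓡 n) x →ₗ[ℝ] TangentSpace (𝓡 n) x :=
  connection X (grad f) x

/-- The shape operator `A v = - D_v N` (the right-hand side is tangent to the hypersurface). -/
def shapeOperator (X N : M → EuclideanSpace ℝ (Fin (n + 1))) (x : M) :
    TangentSpace (𝓡 n) x →ₗ[ℝ] TangentSpace (𝓡 n) x :=
  -(tangentialPart X x ∘L mvfderiv (𝓡 n) N x)

/-- `𝓛_r f = tr (P_r Hess f) - ⟨X, ∇f⟩`. -/
def driftedL (X N : M → EuclideanSpace ℝ (Fin (n + 1))) (r : ℕ) (f : M → ℝ) (x : M) : ℝ :=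
  LinearMap.trace ℝ (TangentSpace (𝓡 n) x) (newton (shapeOperator X N x) r ∘ₗ hess X f x)
    - inner ℝ (X x) (mvfderiv (𝓡 n) X x (grad f x))

end SelfShrinker

end

/-! The shape operator `A` is replaced by its ambient extension `B = -dN ∘ dXᵗ` (`weingarten`),
which is zero on the normal line. Its values are operators on the fixed space ℝⁿ⁺¹, so it is
differentiated as an ordinary vector-valued function and no connection on operators is needed.

Differentiating `σ_r = -⟨X, N⟩` gives `dX(∇σ_r) = B X` (`mvfderiv_grad_sigma`), hence `D_v(BX) =
(D_v B)X + B dX v`. Write `X = dX X^⊤ - σ_r N`. Codazzi's equation turns `(D_v B) dX X^⊤` into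
`(D_{X^⊤} B) dX v`, and differentiating `B N = 0` gives `(D_v B)N = dX A² v`. The tangential part is
`Hess σ_r = C + A - σ_r A²`, where `C` is the tangential compression of `D_{X^⊤} B` (`hess_sigma`).

Now trace against `P_{r-1}`. Since `P_{r-1}` is the gradient of `σ_r` (`hasDerivAt_sigma`,
`mvfderiv_sigma`), `tr(P_{r-1} C) = dσ_r(X^⊤) = ⟨X, ∇σ_r⟩`, which the drift cancels. Newton's
identity gives `tr(P_{r-1} A) = r σ_r`, and the remaining term is `-σ_r tr(P_{r-1} A²)`. This is
item 3; item 4 is the product rule for `σ_r²`, and item 5 reads off signs.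

Smoothness of `N` comes from projecting a fixed vector to the normal lines and normalizing; that of
`σ_r` then follows from the self-shrinker equation. -/

noncomputable section

namespace SelfShrinker

/-! ### Newton's identities and the derivative of the elementary symmetric functions -/

section NewtonIdentities

variable {V : Type*} [NormedAddCommGroup V] [InnerProductSpace ℝ V] [FiniteDimensional ℝ V]

theorem sigma_zero (A : V →ₗ[ℝ] V) : sigma A 0 = 1 := by
  simp [sigma, Multiset.esymm]

theorem trace_pow_eq_sum {A : V →ₗ[ℝ] V} (hA : A.IsSymmetric) (k : ℕ) :
    LinearMap.trace ℝ V (A ^ k) = ∑ i, hA.eigenvalues rfl i ^ k := by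
  have h (i) : (A ^ k) (hA.eigenvectorBasis rfl i) =
      hA.eigenvalues rfl i ^ k • hA.eigenvectorBasis rfl i := by
    induction k with
    | zero => simp
    | succ k ih => simp [pow_succ', ih, hA.apply_eigenvectorBasis, smul_smul, mul_comm]
  rw [LinearMap.trace_eq_sum_inner _ (hA.eigenvectorBasis rfl)]
  simp [h, inner_smul_right]

/-- Newton's identity for the principal curvatures. -/
theorem succ_mul_sigma_succ {A : V →ₗ[ℝ] V} (hA : A.IsSymmetric) (k : ℕ) :
    (k + 1) * sigma A (k + 1) =
      ∑ j ∈ Finset.range (k + 1),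
        (-1) ^ j * sigma A (k - j) * LinearMap.trace ℝ V (A ^ (j + 1)) := by
  have hs (m : ℕ) : sigma A m =
      MvPolynomial.aeval (hA.eigenvalues rfl) (MvPolynomial.esymm (Fin _) ℝ m) := by
    rw [MvPolynomial.aeval_esymm_eq_multiset_esymm, sigma, principalCurvatures,
      hA.roots_charpoly_eq_eigenvalues rfl]
    rfl
  have hp (m : ℕ) : LinearMap.trace ℝ V (A ^ m) =
      MvPolynomial.aeval (hA.eigenvalues rfl) (MvPolynomial.psum (Fin _) ℝ m) := by
    rw [trace_pow_eq_sum hA, MvPolynomial.psum]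
    simp
  have h := congrArg (MvPolynomial.aeval (hA.eigenvalues rfl))
    (MvPolynomial.mul_esymm_eq_sum (Fin (Module.finrank ℝ V)) ℝ (k + 1))
  -- The pairs `(a, b)` with `a + b = k + 1` and `b ≥ 1` are indexed by `j = b - 1`.
  have hset : (Finset.HasAntidiagonal.antidiagonal (k + 1)).filter (fun a ↦ a.1 < k + 1) =
      (Finset.range (k + 1)).image fun j ↦ (k - j, j + 1) := by
    ext ⟨a, b⟩
    simp only [Finset.mem_filter, Finset.HasAntidiagonal.mem_antidiagonal, Finset.mem_image,
      Finset.mem_range, Prod.mk.injEq]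
    constructor
    · intro h
      exact ⟨k - a, by omega, by omega, by omega⟩
    · rintro ⟨j, hj, rfl, rfl⟩
      omega
  rw [hset, Finset.sum_image (by intro a _ b _ h; simp only [Prod.mk.injEq] at h; omega)] at h
  simp only [map_mul, map_sum, map_pow, map_neg, map_one, map_natCast, ← hs, ← hp] at h
  push_cast at h
  rw [h, Finset.mul_sum]
  refine Finset.sum_congr rfl fun j hj ↦ ?_
  obtain ⟨m, rfl⟩ : ∃ m, k = j + m := ⟨k - j, by simp at hj; omega⟩
  rw [Nat.add_sub_cancel_left, ← mul_assoc, ← mul_assoc]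
  congr 2
  have : ((-1 : ℝ) ^ m) * (-1) ^ m = 1 := by rw [← mul_pow]; simp
  rw [pow_add, pow_add, pow_add]
  linear_combination (-1) ^ j * this

theorem newton_zero (A : V →ₗ[ℝ] V) : newton A 0 = 1 := by
  simp [newton, sigma_zero]

theorem newton_succ (A : V →ₗ[ℝ] V) (k : ℕ) :
    newton A (k + 1) = sigma A (k + 1) • 1 - A * newton A k := by
  rw [newton, Finset.sum_range_succ', newton, Finset.mul_sum, sub_eq_neg_add,
    ← Finset.sum_neg_distrib]
  congr 1
  · refine Finset.sum_congr rfl fun j _ ↦ ?_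
    rw [Nat.add_sub_add_right, mul_smul_comm, ← neg_smul, pow_succ', pow_succ']
    congr 1
    ring
  · simp

theorem trace_newton_mul {A : V →ₗ[ℝ] V} (hA : A.IsSymmetric) (k : ℕ) :
    LinearMap.trace ℝ V (newton A k * A) = (k + 1) * sigma A (k + 1) := by
  rw [succ_mul_sigma_succ hA, newton, Finset.sum_mul, map_sum]
  refine Finset.sum_congr rfl fun j _ ↦ ?_
  rw [smul_mul_assoc, map_smul, smul_eq_mul, pow_succ]

/-- The operator form of Newton's identity after differentiation: the first sum collects the
derivatives of the `σ_{k-j}`, the second those of the power sums. The induction uses `P_{k+1} =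
σ_{k+1} - A P_k`, to which each sum contributes its own recursion (`h1`, `h2`). -/
theorem succ_smul_newton {A : V →ₗ[ℝ] V} (hA : A.IsSymmetric) (k : ℕ) :
    (k + 1 : ℝ) • newton A k =
      ∑ j ∈ Finset.range k,
        ((-1) ^ j * LinearMap.trace ℝ V (A ^ (j + 1))) • newton A (k - 1 - j) +
      ∑ j ∈ Finset.range (k + 1), ((-1) ^ j * (j + 1) * sigma A (k - j)) • A ^ j := by
  induction k with
  | zero => simp [newton_zero, sigma_zero]
  | succ k ih =>
    have h1 : ∑ j ∈ Finset.range (k + 1),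
        ((-1) ^ j * LinearMap.trace ℝ V (A ^ (j + 1))) • newton A (k + 1 - 1 - j) =
        ((k + 1) * sigma A (k + 1)) • 1 - A * ∑ j ∈ Finset.range k,
          ((-1) ^ j * LinearMap.trace ℝ V (A ^ (j + 1))) • newton A (k - 1 - j) := by
      rw [succ_mul_sigma_succ hA, Finset.sum_smul, Finset.sum_range_succ, Finset.sum_range_succ,
        Finset.mul_sum, add_sub_right_comm, ← Finset.sum_sub_distrib]
      congr 1
      · refine Finset.sum_congr rfl fun j hj ↦ ?_
        obtain ⟨m, rfl⟩ : ∃ m, k = j + 1 + m := ⟨k - (j + 1), by simp at hj; omega⟩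
        have e1 : j + 1 + m + 1 - 1 - j = m + 1 := by omega
        have e2 : j + 1 + m - j = m + 1 := by omega
        have e3 : j + 1 + m - 1 - j = m := by omega
        rw [e1, e2, e3, newton_succ, smul_sub, smul_smul, mul_smul_comm]
        congr 2
        ring
      · simp [newton_zero, sigma_zero]
    have h2 : ∑ j ∈ Finset.range (k + 1 + 1), ((-1) ^ j * (j + 1) * sigma A (k + 1 - j)) • A ^ j =
        newton A (k + 1) -
          A * ∑ j ∈ Finset.range (k + 1), ((-1) ^ j * (j + 1) * sigma A (k - j)) • A ^ j := by
      rw [newton, eq_sub_iff_add_eq, ← eq_sub_iff_add_eq', ← Finset.sum_sub_distrib,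
        Finset.sum_range_succ' _ (k + 1), Finset.mul_sum]
      simp only [CharP.cast_eq_zero, pow_zero, zero_add, mul_one, sub_self, add_zero]
      refine Finset.sum_congr rfl fun j _ ↦ ?_
      rw [Nat.add_sub_add_right, mul_smul_comm, ← sub_smul, pow_succ', pow_succ']
      congr 1
      push_cast
      ring
    have h3 : ((k + 1 : ℕ) + 1 : ℝ) • newton A (k + 1) =
        newton A (k + 1) + (((k + 1) * sigma A (k + 1)) • 1 - A * ((k + 1 : ℝ) • newton A k)) := by
      rw [mul_smul_comm, mul_smul, ← smul_sub, ← newton_succ]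
      push_cast
      rw [add_smul _ (1 : ℝ), one_smul, add_comm]
    rw [h1, h2, h3, ih, mul_add]
    abel

/-- `B` and `B'` need not commute; cyclicity of the trace makes the `k + 1` terms of the product
rule equal. -/
theorem hasDerivAt_trace_pow {B : ℝ → V →L[ℝ] V} {B' : V →L[ℝ] V} {t : ℝ}
    (hB : HasDerivAt B B' t) (k : ℕ) :
    HasDerivAt (fun s ↦ LinearMap.trace ℝ V ((B s : V →ₗ[ℝ] V) ^ (k + 1)))
      ((k + 1) * LinearMap.trace ℝ V ((B t : V →ₗ[ℝ] V) ^ k * B')) t := by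
  let τ : (V →L[ℝ] V) →L[ℝ] ℝ :=
    LinearMap.toContinuousLinearMap (LinearMap.trace ℝ V ∘ₗ ContinuousLinearMap.coeLM ℝ)
  have h := τ.hasFDerivAt.comp_hasDerivAt t (hB.fun_pow' (k + 1))
  have hτ (T : V →L[ℝ] V) : τ T = LinearMap.trace ℝ V (T : V →ₗ[ℝ] V) := rfl
  have hpow (T : V →L[ℝ] V) (m : ℕ) :
      ((T ^ m : V →L[ℝ] V) : V →ₗ[ℝ] V) = (T : V →ₗ[ℝ] V) ^ m := by
    induction m with
    | zero => rfl
    | succ m ih => rw [pow_succ, pow_succ, ← ih]; rfl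
  have hmul (S T : V →L[ℝ] V) :
      ((S * T : V →L[ℝ] V) : V →ₗ[ℝ] V) = (S : V →ₗ[ℝ] V) * (T : V →ₗ[ℝ] V) := rfl
  refine (h.congr_deriv ?_).congr_of_eventuallyEq (.of_forall fun s ↦ ?_)
  · rw [map_sum, Finset.sum_congr rfl (g := fun _ ↦ LinearMap.trace ℝ V ((B t : V →ₗ[ℝ] V) ^ k * B'))]
    · simp
    · intro i hi
      rw [hτ, hmul, hmul, hpow, hpow, mul_assoc, LinearMap.trace_mul_comm, mul_assoc,
        LinearMap.trace_mul_comm, ← pow_add]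
      congr 3
      simp at hi ⊢
      omega
  · simp [hτ, hpow]

/-- The Newton transformation is the gradient of `σ`: along a curve of symmetric operators
`(σ_{k+1})' = tr (P_k B')`. -/
theorem hasDerivAt_sigma {B : ℝ → V →L[ℝ] V} {B' : V →L[ℝ] V} {t : ℝ}
    (hB : HasDerivAt B B' t) (hsymm : ∀ s, (B s : V →ₗ[ℝ] V).IsSymmetric) (k : ℕ) :
    HasDerivAt (fun s ↦ sigma (B s : V →ₗ[ℝ] V) (k + 1))
      (LinearMap.trace ℝ V (newton (B t : V →ₗ[ℝ] V) k * B')) t := by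
  induction k using Nat.strong_induction_on with
  | _ k ih =>
  -- `d m` is the derivative of `σ_m`: zero for the constant `σ_0`, and `tr (P_{m-1} B')` otherwise.
  -- The zero removes the last term of the first sum below. Newton's identity, solved for `σ_{k+1}`,
  -- is differentiated, so no differentiability of eigenvalues is needed.
  let d : ℕ → ℝ := fun m ↦ Nat.casesOn m 0 fun m ↦
    LinearMap.trace ℝ V (newton (B t : V →ₗ[ℝ] V) m * B')
  have hd (m : ℕ) (hm : m ≤ k) : HasDerivAt (fun s ↦ sigma (B s : V →ₗ[ℝ] V) m) (d m) t := by
    cases m with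
    | zero => simpa [sigma_zero, d] using hasDerivAt_const t (1 : ℝ)
    | succ m => exact ih m hm
  have hk : (k + 1 : ℝ) ≠ 0 := by positivity
  have h := (HasDerivAt.fun_sum (u := Finset.range (k + 1)) fun j _ ↦
    (((hd (k - j) (Nat.sub_le _ _)).const_mul ((-1) ^ j)).mul
      (hasDerivAt_trace_pow hB j))).const_mul ((k + 1 : ℝ)⁻¹)
  refine (h.congr_deriv ?_).congr_of_eventuallyEq (.of_forall fun s ↦ ?_)
  · rw [eq_comm, eq_inv_mul_iff_mul_eq₀ hk, ← smul_eq_mul, ← map_smul, ← smul_mul_assoc,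
      succ_smul_newton (hsymm t), add_mul, map_add, Finset.sum_add_distrib]
    congr 1
    · rw [Finset.sum_range_succ]
      have hd0 : d (k - k) = 0 := by rw [Nat.sub_self]; rfl
      rw [hd0, mul_zero, zero_mul, add_zero, Finset.sum_mul, map_sum]
      refine Finset.sum_congr rfl fun j hj ↦ ?_
      obtain ⟨m, rfl⟩ : ∃ m, k = j + (m + 1) := ⟨k - (j + 1), by simp at hj; omega⟩
      have e : j + (m + 1) - 1 - j = m := by omega
      rw [Nat.add_sub_cancel_left, e, smul_mul_assoc, map_smul, smul_eq_mul]
      ring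
    · rw [Finset.sum_mul, map_sum]
      refine Finset.sum_congr rfl fun j hj ↦ ?_
      rw [smul_mul_assoc, map_smul, smul_eq_mul]
      ring
  · rw [eq_inv_mul_iff_mul_eq₀ hk]
    exact succ_mul_sigma_succ (hsymm s) k

end NewtonIdentities

/-! ### Positive square roots and the trace norm -/

section SquareRoot

variable {V : Type*} [NormedAddCommGroup V] [InnerProductSpace ℝ V] [FiniteDimensional ℝ V]

theorem exists_isSqrt {P : V →ₗ[ℝ] V} (hP : P.IsPositive) : ∃ S, IsSqrt S P := by
  have hs := hP.isSymmetric
  let b := hs.eigenvectorBasis rfl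
  let S : V →ₗ[ℝ] V := b.toBasis.constr ℝ fun i ↦ √(hs.eigenvalues rfl i) • b i
  have hS (i) : S (b i) = √(hs.eigenvalues rfl i) • b i := by
    have := b.toBasis.constr_basis ℝ (fun i ↦ √(hs.eigenvalues rfl i) • b i) i
    rwa [b.coe_toBasis] at this
  have hSv (v : V) : S v = ∑ i, (√(hs.eigenvalues rfl i) * inner ℝ (b i) v) • b i := by
    conv_lhs => rw [← b.sum_repr' v]
    simp [hS, smul_smul, mul_comm]
  have hin (u v : V) : inner ℝ (S u) v =
      ∑ i, √(hs.eigenvalues rfl i) * inner ℝ (b i) u * inner ℝ (b i) v := by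
    simp [hSv, sum_inner, inner_smul_left]
  refine ⟨S, ⟨⟨fun u v ↦ ?_, fun v ↦ ?_⟩, ?_⟩⟩
  · rw [hin, real_inner_comm, hin]
    exact Finset.sum_congr rfl fun i _ ↦ by ring
  · rw [hin]
    simp only [RCLike.re_to_real]
    exact Finset.sum_nonneg fun i _ ↦ by
      rw [mul_assoc]
      exact mul_nonneg (Real.sqrt_nonneg _) (mul_self_nonneg _)
  · refine b.toBasis.ext fun i ↦ ?_
    have h0 := hP.nonneg_eigenvalues rfl i
    rw [b.coe_toBasis]
    simp only [LinearMap.comp_apply, hS, map_smul, smul_smul]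
    rw [Real.mul_self_sqrt h0]
    exact (hs.apply_eigenvectorBasis rfl i).symm

/-- If `S v = μ v`, then `w = T v - μ v` satisfies `(T + μ) w = (T² - μ²) v = 0`. For `μ > 0`
positivity of `T` forces `w = 0`, so `T` agrees with `S` on an eigenbasis of `S`. -/
theorem IsSqrt.unique {S T P : V →ₗ[ℝ] V} (hS : IsSqrt S P) (hT : IsSqrt T P) : S = T := by
  have hs := hS.1.isSymmetric
  let b := hs.eigenvectorBasis rfl
  refine b.toBasis.ext fun i ↦ ?_
  rw [b.coe_toBasis]
  set μ := hs.eigenvalues rfl i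
  set v := b i
  have hSv : S v = μ • v := hs.apply_eigenvectorBasis rfl i
  have hTT : T (T v) = (μ * μ) • v := by
    have := LinearMap.congr_fun (hT.2.trans hS.2.symm) v
    simpa [hSv, smul_smul] using this
  have hμ : 0 ≤ μ := hS.1.nonneg_eigenvalues rfl i
  rw [hSv, eq_comm, ← sub_eq_zero]
  set w := T v - μ • v
  have hw : T w = -(μ • w) := by
    simp only [w, map_sub, map_smul, hTT, smul_sub, smul_smul]
    abel
  have h1 := hT.1.inner_nonneg_left w
  rw [hw, inner_neg_left, real_inner_smul_left, real_inner_self_eq_norm_sq] at h1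
  -- For `μ = 0` the relation `(T + μ) w = 0` alone says too little; instead `‖T v‖² = ⟨T² v, v⟩ =
  -- 0`.
  rcases hμ.eq_or_lt with h | h
  · have h2 : inner ℝ (T v) (T v) = (0 : ℝ) := by
      rw [hT.1.isSymmetric, hTT, ← h]
      simp
    simpa [w, ← h] using h2
  · have : ‖w‖ ^ 2 ≤ 0 := by nlinarith
    simpa using le_antisymm this (sq_nonneg _)

theorem traceNormSq_comp {S P A : V →ₗ[ℝ] V} (hS : IsSqrt S P) (hA : A.IsSymmetric) :
    traceNormSq (S ∘ₗ A) = LinearMap.trace ℝ V (P ∘ₗ A ∘ₗ A) := by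
  have hS' : S.adjoint = S := hS.1.adjoint_eq
  have hA' : A.adjoint = A := (LinearMap.isSymmetric_iff_isSelfAdjoint A).1 hA
  rw [traceNormSq, LinearMap.adjoint_comp, hS', hA', ← hS.2]
  change LinearMap.trace ℝ V (A * S * (S * A)) = LinearMap.trace ℝ V (S * S * (A * A))
  rw [mul_assoc, LinearMap.trace_mul_comm]
  simp only [mul_assoc]

end SquareRoot

/-! ### Linear algebra of a hyperplane and its unit normal -/

section LinearHypersurface

variable {V W : Type*} [NormedAddCommGroup V] [InnerProductSpace ℝ V] [CompleteSpace V]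
  [NormedAddCommGroup W] [InnerProductSpace ℝ W] [CompleteSpace W] {L : V →L[ℝ] W} {ν : W}

theorem adjoint_apply_of_inner_map (hL : ∀ u v, (inner ℝ (L u) (L v) : ℝ) = inner ℝ u v) (v : V) :
    L.adjoint (L v) = v := by
  refine ext_inner_right ℝ fun u ↦ ?_
  rw [ContinuousLinearMap.adjoint_inner_left, hL]

theorem adjoint_normal (hν : ∀ v, (inner ℝ ν (L v) : ℝ) = 0) : L.adjoint ν = 0 := by
  refine ext_inner_right ℝ fun u ↦ ?_
  rw [ContinuousLinearMap.adjoint_inner_left, hν, inner_zero_left]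

variable [FiniteDimensional ℝ V] [FiniteDimensional ℝ W]

omit [FiniteDimensional ℝ V] in
/-- The image of an isometric embedding of codimension one and its unit normal `ν` span. -/
theorem map_adjoint_add_inner_smul (hL : ∀ u v, (inner ℝ (L u) (L v) : ℝ) = inner ℝ u v)
    (hν1 : ‖ν‖ = 1) (hν : ∀ v, (inner ℝ ν (L v) : ℝ) = 0)
    (hfr : Module.finrank ℝ W = Module.finrank ℝ V + 1) (w : W) :
    L (L.adjoint w) + (inner ℝ ν w : ℝ) • ν = w := by
  have hinj : Function.Injective (L : V →ₗ[ℝ] W) :=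
    Function.LeftInverse.injective (adjoint_apply_of_inner_map hL)
  let K := LinearMap.range (L : V →ₗ[ℝ] W)
  have h1 : Module.finrank ℝ Kᗮ = 1 := by
    have := K.finrank_add_finrank_orthogonal
    rw [hfr, LinearMap.finrank_range_of_inj hinj] at this
    omega
  have hνK : ν ∈ Kᗮ := by
    rw [Submodule.mem_orthogonal']
    rintro _ ⟨v, rfl⟩
    exact hν v
  have hwK : w - L (L.adjoint w) ∈ Kᗮ := by
    rw [Submodule.mem_orthogonal]
    rintro _ ⟨v, rfl⟩
    change inner ℝ (L v) _ = (0 : ℝ)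
    rw [inner_sub_right, hL, ContinuousLinearMap.adjoint_inner_right, sub_self]
  have hν0 : (⟨ν, hνK⟩ : Kᗮ) ≠ 0 := by
    intro h
    have : ν = 0 := congrArg Subtype.val h
    simp [this] at hν1
  obtain ⟨c, hc⟩ := (finrank_eq_one_iff_of_nonzero' _ hν0).1 h1 ⟨_, hwK⟩
  have hc' : c • ν = w - L (L.adjoint w) := congrArg Subtype.val hc
  have hcν : c = inner ℝ ν w := by
    have := congrArg (fun z ↦ (inner ℝ ν z : ℝ)) hc'
    simpa [inner_smul_right, inner_sub_right, hν, real_inner_self_eq_norm_sq, hν1] using this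
  rw [← hcν, hc']
  abel

omit [FiniteDimensional ℝ V] [FiniteDimensional ℝ W] in
-- The inner factors `Lᵗ L = 1` telescope. The exponent must be positive: `L Lᵗ` is only a
-- projection, not the identity of `W`.
theorem pow_succ_of_eq_conj {A : V →L[ℝ] V} {B : W →L[ℝ] W}
    (hL : ∀ u v, (inner ℝ (L u) (L v) : ℝ) = inner ℝ u v) (hB : B = L ∘L A ∘L L.adjoint) (k : ℕ) :
    (B : W →ₗ[ℝ] W) ^ (k + 1) = (L : V →ₗ[ℝ] W) ∘ₗ ((A : V →ₗ[ℝ] V) ^ (k + 1)) ∘ₗ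
      (L.adjoint : W →ₗ[ℝ] V) := by
  induction k with
  | zero => simpa using congrArg ContinuousLinearMap.toLinearMap hB
  | succ k ih =>
    ext w
    rw [pow_succ', ih, pow_succ' _ (k + 1)]
    simp [hB, adjoint_apply_of_inner_map hL]

/-- Extending by zero adds a zero eigenvalue. All traces of positive powers agree, and Newton's
identity recovers every `σ_k` from them. -/
theorem sigma_eq_of_eq_conj {A : V →L[ℝ] V} {B : W →L[ℝ] W}
    (hL : ∀ u v, (inner ℝ (L u) (L v) : ℝ) = inner ℝ u v) (hB : B = L ∘L A ∘L L.adjoint)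
    (hA : (A : V →ₗ[ℝ] V).IsSymmetric) (hBs : (B : W →ₗ[ℝ] W).IsSymmetric) (k : ℕ) :
    sigma (B : W →ₗ[ℝ] W) k = sigma (A : V →ₗ[ℝ] V) k := by
  induction k using Nat.strong_induction_on with
  | _ k ih =>
  cases k with
  | zero => simp [sigma_zero]
  | succ k =>
    have hk : (k + 1 : ℝ) ≠ 0 := by positivity
    apply mul_left_cancel₀ hk
    rw [succ_mul_sigma_succ hA, succ_mul_sigma_succ hBs]
    refine Finset.sum_congr rfl fun j _ ↦ ?_
    rw [ih (k - j) (by omega), pow_succ_of_eq_conj hL hB, LinearMap.trace_comp_comm']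
    congr 2
    ext v
    simp [adjoint_apply_of_inner_map hL]

theorem trace_eq_trace_compression_add (hL : ∀ u v, (inner ℝ (L u) (L v) : ℝ) = inner ℝ u v)
    (hν1 : ‖ν‖ = 1) (hν : ∀ v, (inner ℝ ν (L v) : ℝ) = 0)
    (hfr : Module.finrank ℝ W = Module.finrank ℝ V + 1) (C : W →ₗ[ℝ] W) :
    LinearMap.trace ℝ W C =
      LinearMap.trace ℝ V ((L.adjoint : W →ₗ[ℝ] V) ∘ₗ C ∘ₗ (L : V →ₗ[ℝ] W)) + inner ℝ ν (C ν) := by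
  have h : C = (C ∘ₗ (L : V →ₗ[ℝ] W)) ∘ₗ (L.adjoint : W →ₗ[ℝ] V) +
      (innerₗ W ν).smulRight (C ν) := by
    ext w
    conv_lhs => rw [← map_adjoint_add_inner_smul hL hν1 hν hfr w]
    simp
  conv_lhs => rw [h]
  rw [map_add, LinearMap.trace_comp_comm', LinearMap.trace_smulRight]
  rfl

/-- The terms with `j ≥ 1` factor through `L`. Only the identity term `j = 0` sees the normal line,
where it contributes `⟨ν, C ν⟩`; this is why `hC` is required. -/
theorem trace_newton_mul_of_eq_conj {A : V →L[ℝ] V} {B : W →L[ℝ] W}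
    (hL : ∀ u v, (inner ℝ (L u) (L v) : ℝ) = inner ℝ u v) (hB : B = L ∘L A ∘L L.adjoint)
    (hA : (A : V →ₗ[ℝ] V).IsSymmetric) (hBs : (B : W →ₗ[ℝ] W).IsSymmetric)
    (hν1 : ‖ν‖ = 1) (hν : ∀ v, (inner ℝ ν (L v) : ℝ) = 0)
    (hfr : Module.finrank ℝ W = Module.finrank ℝ V + 1) (C : W →ₗ[ℝ] W)
    (hC : (inner ℝ ν (C ν) : ℝ) = 0) (k : ℕ) :
    LinearMap.trace ℝ W (newton (B : W →ₗ[ℝ] W) k * C) =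
      LinearMap.trace ℝ V (newton (A : V →ₗ[ℝ] V) k *
        ((L.adjoint : W →ₗ[ℝ] V) ∘ₗ C ∘ₗ (L : V →ₗ[ℝ] W))) := by
  simp only [newton, Finset.sum_mul, map_sum, smul_mul_assoc, map_smul,
    sigma_eq_of_eq_conj hL hB hA hBs]
  refine Finset.sum_congr rfl fun j _ ↦ congrArg _ ?_
  cases j with
  | zero => simp [trace_eq_trace_compression_add hL hν1 hν hfr C, hC]
  | succ j =>
    rw [pow_succ_of_eq_conj hL hB]
    change LinearMap.trace ℝ W ((L : V →ₗ[ℝ] W) ∘ₗ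
      (((A : V →ₗ[ℝ] V) ^ (j + 1)) ∘ₗ (L.adjoint : W →ₗ[ℝ] V) ∘ₗ C)) = _
    rw [LinearMap.trace_comp_comm']
    rfl

end LinearHypersurface

/-! ### Smooth dependence of the left inverse on an injective operator -/

section PseudoInverse

variable {V W : Type*} [NormedAddCommGroup V] [InnerProductSpace ℝ V] [FiniteDimensional ℝ V]
  [CompleteSpace V] [NormedAddCommGroup W] [InnerProductSpace ℝ W] [FiniteDimensional ℝ W]
  [CompleteSpace W]

/-- The adjoint as a continuous linear map between spaces of real operators. -/
def adjointCLM : (V →L[ℝ] W) →L[ℝ] (W →L[ℝ] V) :=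
  LinearMap.toContinuousLinearMap
    { toFun := fun T ↦ T.adjoint
      map_add' := fun S T ↦ map_add _ S T
      map_smul' := fun c T ↦ by simp }

/-- The left inverse `(DᵗD)⁻¹Dᵗ` of an injective operator, vanishing on the normal space. -/
def pseudoInverse (D : V →L[ℝ] W) : W →L[ℝ] V := (D.adjoint ∘L D).inverse ∘L D.adjoint

omit [FiniteDimensional ℝ W] in
theorem isInvertible_adjoint_comp_self {D : V →L[ℝ] W} (hD : Function.Injective D) :
    (D.adjoint ∘L D).IsInvertible := by
  have hinj : Function.Injective (D.adjoint ∘L D : V →ₗ[ℝ] V) := by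
    rw [← LinearMap.ker_eq_bot, LinearMap.ker_eq_bot']
    intro v hv
    have h : (inner ℝ (D v) (D v) : ℝ) = 0 := by
      rw [← ContinuousLinearMap.adjoint_inner_left]
      simp only [ContinuousLinearMap.coe_coe, ContinuousLinearMap.comp_apply] at hv
      rw [hv, inner_zero_left]
    exact hD ((inner_self_eq_zero.1 h).trans (map_zero D).symm)
  exact ⟨(LinearEquiv.ofInjectiveEndo _ hinj).toContinuousLinearEquiv, by ext v; rfl⟩

omit [FiniteDimensional ℝ W] in
theorem pseudoInverse_apply {D : V →L[ℝ] W} (hD : Function.Injective D) (v : V) :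
    pseudoInverse D (D v) = v :=
  (isInvertible_adjoint_comp_self hD).inverse_apply_self v

omit [FiniteDimensional ℝ V] [FiniteDimensional ℝ W] in
theorem pseudoInverse_normal {D : V →L[ℝ] W} {ν : W} (hν : ∀ v, (inner ℝ ν (D v) : ℝ) = 0) :
    pseudoInverse D ν = 0 := by
  rw [pseudoInverse, ContinuousLinearMap.comp_apply, adjoint_normal hν, map_zero]

theorem contDiffAt_pseudoInverse {D : V →L[ℝ] W} (hD : Function.Injective D) {k : WithTop ℕ∞} :
    ContDiffAt ℝ k (pseudoInverse (V := V) (W := W)) D := by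
  have hadj : ContDiffAt ℝ k (adjointCLM (V := V) (W := W)) D :=
    (adjointCLM (V := V) (W := W)).contDiff.contDiffAt
  have hcomp : ContDiffAt ℝ k (fun D : V →L[ℝ] W ↦ adjointCLM D ∘L D) D :=
    hadj.clm_comp contDiffAt_id
  have hinv : ContDiffAt ℝ k ContinuousLinearMap.inverse (adjointCLM D ∘L D) :=
    (isInvertible_adjoint_comp_self hD).contDiffAt_map_inverse
  have h := (ContDiffAt.comp (f := fun D : V →L[ℝ] W ↦ adjointCLM D ∘L D) D hinv hcomp).clm_comp hadj
  exact h

end PseudoInverse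

/-! ### Derivatives at all points of a chart -/

section Chart

variable {n : ℕ} {M : Type*} [TopologicalSpace M] [ChartedSpace (EuclideanSpace ℝ (Fin n)) M]
  [IsManifold (𝓡 n) ∞ M] {F : Type*} [NormedAddCommGroup F] [NormedSpace ℝ F]

/-- `T` is the derivative of the inverse chart at `q`, and the formula is the chain rule. A single
`T` serves all `f`, so derivatives of `X` and `N` can be compared. -/
theorem exists_frame (x : M) {q : EuclideanSpace ℝ (Fin n)} (hq : q ∈ (extChartAt (𝓡 n) x).target) :
    ∃ T : EuclideanSpace ℝ (Fin n) ≃L[ℝ] TangentSpace (𝓡 n) ((extChartAt (𝓡 n) x).symm q),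
      ∀ f : M → F, MDifferentiableAt (𝓡 n) 𝓘(ℝ, F) f ((extChartAt (𝓡 n) x).symm q) →
        ∀ v, fderiv ℝ (f ∘ (extChartAt (𝓡 n) x).symm) q v =
          mvfderiv (𝓡 n) f ((extChartAt (𝓡 n) x).symm q) (T v) := by
  obtain ⟨T, hT⟩ := isInvertible_mfderivWithin_extChartAt_symm (I := 𝓡 n) hq
  refine ⟨T, fun f hf v ↦ ?_⟩
  have hd := mdifferentiableWithinAt_extChartAt_symm (I := 𝓡 n) hq
  have hc := mfderiv_comp_mfderivWithin q hf hd ((𝓡 n).uniqueMDiffOn q (by simp))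
  have e : fderiv ℝ (f ∘ (extChartAt (𝓡 n) x).symm) q =
      mfderivWithin (𝓡 n) 𝓘(ℝ, F) (f ∘ (extChartAt (𝓡 n) x).symm) (Set.range (𝓡 n)) q := by
    rw [ModelWithCorners.range_eq_univ, mfderivWithin_univ, mfderiv_eq_fderiv]
  rw [e, hc, ← hT]
  rfl

theorem contDiffAt_comp_extChartAt_symm {f : M → F} (hf : ContMDiff (𝓡 n) 𝓘(ℝ, F) ∞ f) (x : M)
    {q : EuclideanSpace ℝ (Fin n)} (hq : q ∈ (extChartAt (𝓡 n) x).target) :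
    ContDiffAt ℝ ∞ (f ∘ (extChartAt (𝓡 n) x).symm) q := by
  have h := (hf.comp_contMDiffOn (contMDiffOn_extChartAt_symm (I := 𝓡 n) (n := ∞) x)).contDiffOn
  exact h.contDiffAt ((isOpen_extChartAt_target x).mem_nhds hq)

omit [IsManifold (𝓡 n) ∞ M] in
theorem contMDiffAt_of_comp_extChartAt_symm {f : M → F} {x : M}
    (hf : ContDiffAt ℝ ∞ (f ∘ (extChartAt (𝓡 n) x).symm) (extChartAt (𝓡 n) x x)) :
    ContMDiffAt (𝓡 n) 𝓘(ℝ, F) ∞ f x := by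
  refine (hf.contMDiffAt.comp x (contMDiffAt_extChartAt (n := ∞))).congr_of_eventuallyEq ?_
  filter_upwards [extChartAt_source_mem_nhds (I := 𝓡 n) x] with y hy
  exact (congrArg f ((extChartAt (𝓡 n) x).left_inv hy)).symm

end Chart

/-! ### Smoothness of the normal and of the extended shape operator -/

section Hypersurface

variable {n : ℕ} {M : Type*} [TopologicalSpace M] [ChartedSpace (EuclideanSpace ℝ (Fin n)) M]
  [IsManifold (𝓡 n) ∞ M] [RiemannianBundle (fun x : M ↦ TangentSpace (𝓡 n) x)]
  {X N : M → EuclideanSpace ℝ (Fin (n + 1))}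

omit [IsManifold (𝓡 n) ∞ M] [RiemannianBundle fun x : M ↦ TangentSpace (𝓡 n) x] in
theorem finrank_tangentSpace_add_one (x : M) :
    Module.finrank ℝ (EuclideanSpace ℝ (Fin (n + 1))) =
      Module.finrank ℝ (TangentSpace (𝓡 n) x) + 1 := by
  have h : Module.finrank ℝ (TangentSpace (𝓡 n) x) =
    Module.finrank ℝ (EuclideanSpace ℝ (Fin n)) := rfl
  rw [h, finrank_euclideanSpace_fin, finrank_euclideanSpace_fin]

omit [IsManifold (𝓡 n) ∞ M] in
theorem tangent_add_normal (hX : IsIsometricImmersion X) (hN : IsUnitNormal X N) (x : M)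
    (w : EuclideanSpace ℝ (Fin (n + 1))) :
    mvfderiv (𝓡 n) X x (tangentialPart X x w) + (inner ℝ (N x) w : ℝ) • N x = w :=
  map_adjoint_add_inner_smul (hX.inner_mvfderiv x) (hN.norm_eq_one x) (hN.inner_mvfderiv x)
    (finrank_tangentSpace_add_one x) w

omit [IsManifold (𝓡 n) ∞ M] in
theorem mdifferentiableAt_immersion (hX : IsIsometricImmersion X) (x : M) :
    MDifferentiableAt (𝓡 n) (𝓡 (n + 1)) X x :=
  hX.contMDiff.mdifferentiable (by norm_num) x

theorem injective_fderiv_chart (hX : IsIsometricImmersion X) (x : M)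
    {q : EuclideanSpace ℝ (Fin n)} (hq : q ∈ (extChartAt (𝓡 n) x).target) :
    Function.Injective (fderiv ℝ (X ∘ (extChartAt (𝓡 n) x).symm) q) := by
  obtain ⟨T, hT⟩ := exists_frame (F := EuclideanSpace ℝ (Fin (n + 1))) x hq
  intro u v huv
  rw [hT X (mdifferentiableAt_immersion hX _), hT X (mdifferentiableAt_immersion hX _)] at huv
  have := congrArg (tangentialPart X ((extChartAt (𝓡 n) x).symm q)) huv
  rw [hX.tangentialPart_mvfderiv, hX.tangentialPart_mvfderiv] at this
  exact T.injective this

theorem inner_normal_fderiv_chart (hX : IsIsometricImmersion X) (hN : IsUnitNormal X N) (x : M)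
    {q : EuclideanSpace ℝ (Fin n)} (hq : q ∈ (extChartAt (𝓡 n) x).target)
    (v : EuclideanSpace ℝ (Fin n)) :
    (inner ℝ (N ((extChartAt (𝓡 n) x).symm q))
      (fderiv ℝ (X ∘ (extChartAt (𝓡 n) x).symm) q v) : ℝ) = 0 := by
  obtain ⟨T, hT⟩ := exists_frame (F := EuclideanSpace ℝ (Fin (n + 1))) x hq
  rw [hT X (mdifferentiableAt_immersion hX _), hN.inner_mvfderiv]

/-- The adjoint of the chart derivative of `X` refers to the Euclidean product of the chart, not to
the metric of `M`. The pseudo-inverse avoids this: it is determined by inverting the derivative on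
tangent vectors and killing the normal, as `tangentialPart` does. -/
theorem exists_frame_pseudoInverse (hX : IsIsometricImmersion X) (hN : IsUnitNormal X N) (x : M)
    {q : EuclideanSpace ℝ (Fin n)} (hq : q ∈ (extChartAt (𝓡 n) x).target) :
    ∃ T : EuclideanSpace ℝ (Fin n) ≃L[ℝ] TangentSpace (𝓡 n) ((extChartAt (𝓡 n) x).symm q),
      (∀ f : M → EuclideanSpace ℝ (Fin (n + 1)),
        MDifferentiableAt (𝓡 n) (𝓡 (n + 1)) f ((extChartAt (𝓡 n) x).symm q) →
        ∀ v, fderiv ℝ (f ∘ (extChartAt (𝓡 n) x).symm) q v =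
          mvfderiv (𝓡 n) f ((extChartAt (𝓡 n) x).symm q) (T v)) ∧
      ∀ w, T (pseudoInverse (fderiv ℝ (X ∘ (extChartAt (𝓡 n) x).symm) q) w) =
        tangentialPart X ((extChartAt (𝓡 n) x).symm q) w := by
  obtain ⟨T, hT⟩ := exists_frame (F := EuclideanSpace ℝ (Fin (n + 1))) x hq
  refine ⟨T, hT, fun w ↦ ?_⟩
  have h1 : mvfderiv (𝓡 n) X _ (tangentialPart X ((extChartAt (𝓡 n) x).symm q) w) =
      fderiv ℝ (X ∘ (extChartAt (𝓡 n) x).symm) q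
        (T.symm (tangentialPart X ((extChartAt (𝓡 n) x).symm q) w)) := by
    rw [hT X (mdifferentiableAt_immersion hX _), T.apply_symm_apply]
  conv_lhs => rw [← tangent_add_normal hX hN ((extChartAt (𝓡 n) x).symm q) w, h1, map_add, map_smul,
    pseudoInverse_apply (injective_fderiv_chart hX x hq),
    pseudoInverse_normal (inner_normal_fderiv_chart hX hN x hq), smul_zero, add_zero,
    T.apply_symm_apply]

theorem contDiffAt_fderiv {G : EuclideanSpace ℝ (Fin n) → EuclideanSpace ℝ (Fin (n + 1))}
    {q : EuclideanSpace ℝ (Fin n)} (hG : ContDiffAt ℝ ∞ G q) : ContDiffAt ℝ ∞ (fderiv ℝ G) q :=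
  hG.fderiv_right (by norm_num)

theorem contDiffAt_pseudoInverse_chart (hX : IsIsometricImmersion X) (x : M)
    {q : EuclideanSpace ℝ (Fin n)} (hq : q ∈ (extChartAt (𝓡 n) x).target) :
    ContDiffAt ℝ ∞
      (fun q ↦ pseudoInverse (fderiv ℝ (X ∘ (extChartAt (𝓡 n) x).symm) q)) q :=
  (contDiffAt_pseudoInverse (injective_fderiv_chart hX x hq)).comp q
    (contDiffAt_fderiv (contDiffAt_comp_extChartAt_symm hX.contMDiff x hq))

/-- The normal field of a smooth immersion is smooth. -/
theorem IsUnitNormal.contMDiff (hX : IsIsometricImmersion X) (hN : IsUnitNormal X N) :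
    ContMDiff (𝓡 n) (𝓡 (n + 1)) ∞ N := by
  intro x
  apply contMDiffAt_of_comp_extChartAt_symm
  set φ := extChartAt (𝓡 n) x
  -- The component of the fixed vector `N x` along the normal line at `q`; it is smooth because it
  -- involves only derivatives of `X`.
  let u : EuclideanSpace ℝ (Fin n) → EuclideanSpace ℝ (Fin (n + 1)) := fun q ↦
    N x - fderiv ℝ (X ∘ φ.symm) q (pseudoInverse (fderiv ℝ (X ∘ φ.symm) q) (N x))
  have hpt : φ x ∈ φ.target := mem_extChartAt_target x
  have hpx : φ.symm (φ x) = x := extChartAt_to_inv x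
  have hu : ContDiffAt ℝ ∞ u (φ x) := contDiffAt_const.sub
    ((contDiffAt_fderiv (contDiffAt_comp_extChartAt_symm hX.contMDiff x hpt)).clm_apply
      ((contDiffAt_pseudoInverse_chart hX x hpt).clm_apply contDiffAt_const))
  have hu' (q) (hq : q ∈ φ.target) :
      u q = (inner ℝ (N (φ.symm q)) (N x) : ℝ) • N (φ.symm q) := by
    obtain ⟨T, hT, hT'⟩ := exists_frame_pseudoInverse hX hN x hq
    change N x - fderiv ℝ (X ∘ φ.symm) q (pseudoInverse (fderiv ℝ (X ∘ φ.symm) q) (N x)) = _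
    rw [hT X (mdifferentiableAt_immersion hX _), hT', sub_eq_iff_eq_add']
    exact (tangent_add_normal hX hN _ _).symm
  have hu0 : u (φ x) ≠ 0 := by
    rw [hu' _ hpt, hpx, real_inner_self_eq_norm_sq, hN.norm_eq_one, one_pow, one_smul]
    intro h
    simpa [h] using hN.norm_eq_one x
  have hcont : ContinuousAt (fun q ↦ (inner ℝ (N (φ.symm q)) (N x) : ℝ)) (φ x) := by
    have h1 : ContinuousAt φ.symm (φ x) := continuousAt_extChartAt_symm x
    exact ((hN.continuous.continuousAt).comp h1).inner continuousAt_const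
  -- Continuity of `N` fixes the sign: near `x`, normalizing `u` yields `N` and not `-N`.
  have hpos : ∀ᶠ q in nhds (φ x), 0 < (inner ℝ (N (φ.symm q)) (N x) : ℝ) := by
    refine hcont.eventually (lt_mem_nhds ?_)
    change 0 < (inner ℝ (N (φ.symm (φ x))) (N x) : ℝ)
    rw [hpx, real_inner_self_eq_norm_sq, hN.norm_eq_one]
    norm_num
  have hnorm : ContDiffAt ℝ ∞ (fun q ↦ ‖u q‖⁻¹ • u q) (φ x) :=
    ((hu.norm ℝ hu0).inv (norm_ne_zero_iff.2 hu0)).smul hu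
  refine hnorm.congr_of_eventuallyEq ?_
  filter_upwards [hpos, extChartAt_target_mem_nhds x] with q hq hqt
  rw [hu' q hqt, norm_smul, hN.norm_eq_one, mul_one, Real.norm_of_nonneg hq.le, smul_smul,
    inv_mul_cancel₀ hq.ne', one_smul]
  rfl

/-- The shape operator extended to the ambient space by zero on the normal line. -/
def weingarten (X N : M → EuclideanSpace ℝ (Fin (n + 1))) (x : M) :
    EuclideanSpace ℝ (Fin (n + 1)) →L[ℝ] EuclideanSpace ℝ (Fin (n + 1)) :=
  -(mvfderiv (𝓡 n) N x ∘L tangentialPart X x)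

theorem mdifferentiableAt_normal (hX : IsIsometricImmersion X) (hN : IsUnitNormal X N) (x : M) :
    MDifferentiableAt (𝓡 n) (𝓡 (n + 1)) N x :=
  (hN.contMDiff hX).mdifferentiable (by norm_num) x

theorem weingarten_chart (hX : IsIsometricImmersion X) (hN : IsUnitNormal X N) (x : M)
    {q : EuclideanSpace ℝ (Fin n)} (hq : q ∈ (extChartAt (𝓡 n) x).target) :
    weingarten X N ((extChartAt (𝓡 n) x).symm q) =
      -(fderiv ℝ (N ∘ (extChartAt (𝓡 n) x).symm) q ∘L
        pseudoInverse (fderiv ℝ (X ∘ (extChartAt (𝓡 n) x).symm) q)) := by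
  obtain ⟨T, hT, hT'⟩ := exists_frame_pseudoInverse hX hN x hq
  ext1 w
  simp only [weingarten, neg_apply, ContinuousLinearMap.comp_apply]
  rw [hT N (mdifferentiableAt_normal hX hN _), hT']

theorem contDiffAt_weingarten_chart (hX : IsIsometricImmersion X) (hN : IsUnitNormal X N) (x : M)
    {q : EuclideanSpace ℝ (Fin n)} (hq : q ∈ (extChartAt (𝓡 n) x).target) :
    ContDiffAt ℝ ∞ (weingarten X N ∘ (extChartAt (𝓡 n) x).symm) q := by
  have h : ContDiffAt ℝ ∞ (fun q ↦ -(fderiv ℝ (N ∘ (extChartAt (𝓡 n) x).symm) q ∘L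
        pseudoInverse (fderiv ℝ (X ∘ (extChartAt (𝓡 n) x).symm) q))) q :=
    ((contDiffAt_fderiv (contDiffAt_comp_extChartAt_symm (hN.contMDiff hX) x hq)).clm_comp
      (contDiffAt_pseudoInverse_chart hX x hq)).neg
  refine h.congr_of_eventuallyEq ?_
  filter_upwards [(isOpen_extChartAt_target x).mem_nhds hq] with q' hq'
  exact weingarten_chart hX hN x hq'

theorem mdifferentiableAt_weingarten (hX : IsIsometricImmersion X) (hN : IsUnitNormal X N)
    (x : M) : MDifferentiableAt (𝓡 n) 𝓘(ℝ, EuclideanSpace ℝ (Fin (n + 1)) →L[ℝ]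
      EuclideanSpace ℝ (Fin (n + 1))) (weingarten X N) x :=
  (contMDiffAt_of_comp_extChartAt_symm (contDiffAt_weingarten_chart hX hN x
    (mem_extChartAt_target x))).mdifferentiableAt (by norm_num)

end Hypersurface

/-! ### Consequences of the symmetry of second derivatives -/

section SecondDerivatives

variable {E F G : Type*} [NormedAddCommGroup E] [NormedSpace ℝ E] [NormedAddCommGroup F]
  [NormedSpace ℝ F] [NormedAddCommGroup G] [NormedSpace ℝ G]

theorem fderiv_clm_apply_apply {B : E → F →L[ℝ] G} {Y : E → F} {p : E}
    (hB : DifferentiableAt ℝ B p) (hY : DifferentiableAt ℝ Y p) (v : E) :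
    fderiv ℝ (fun q ↦ B q (Y q)) p v = fderiv ℝ B p v (Y p) + B p (fderiv ℝ Y p v) := by
  rw [fderiv_clm_apply hB hY]
  simp [add_comm]

theorem differentiableAt_fderiv_of_contDiffAt {f : E → F} {p : E} (hf : ContDiffAt ℝ 2 f p) :
    DifferentiableAt ℝ (fderiv ℝ f) p :=
  (hf.fderiv_right (m := 1) (by norm_num)).differentiableAt (by norm_num)

theorem fderiv_fderiv_comm {f : E → F} {p : E} (hf : ContDiffAt ℝ 2 f p) (u v : E) :
    fderiv ℝ (fderiv ℝ f) p u v = fderiv ℝ (fderiv ℝ f) p v u :=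
  (hf.isSymmSndFDerivAt (by simp)).eq u v

/-- The core of Codazzi's equation. Differentiating `B(df z) = -dg z` with `z` constant gives `(D_u
B)(df z) = -D²g(u, z) - B(D²f(u, z))`, which is symmetric in `u` and `z`. -/
theorem fderiv_apply_comm_of_comp_fderiv_eq {B : E → F →L[ℝ] G} {f : E → F} {g : E → G} {p : E}
    (hB : DifferentiableAt ℝ B p) (hf : ContDiffAt ℝ 2 f p) (hg : ContDiffAt ℝ 2 g p)
    (h : ∀ᶠ q in nhds p, ∀ u, B q (fderiv ℝ f q u) = -fderiv ℝ g q u) (v w : E) :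
    fderiv ℝ B p v (fderiv ℝ f p w) = fderiv ℝ B p w (fderiv ℝ f p v) := by
  have hf' := differentiableAt_fderiv_of_contDiffAt hf
  have hg' := differentiableAt_fderiv_of_contDiffAt hg
  have key (u z : E) : fderiv ℝ B p u (fderiv ℝ f p z) =
      -fderiv ℝ (fderiv ℝ g) p u z - B p (fderiv ℝ (fderiv ℝ f) p u z) := by
    have h0 : (fun q ↦ B q (fderiv ℝ f q z)) =ᶠ[nhds p] fun q ↦ -fderiv ℝ g q z :=
      h.mono fun q hq ↦ hq z
    have h1 := fderiv_clm_apply_apply hB (hf'.clm_apply (differentiableAt_const z)) u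
    rw [h0.fderiv_eq, fderiv_fun_neg, neg_apply,
      fderiv_clm_apply_apply hf' (differentiableAt_const z),
      fderiv_clm_apply_apply hg' (differentiableAt_const z)] at h1
    simp only [fderiv_fun_const, Pi.zero_apply, zero_apply, map_zero, add_zero] at h1
    rw [h1, add_sub_cancel_right]
  rw [key, key, fderiv_fderiv_comm hf, fderiv_fderiv_comm hg]

theorem inner_fderiv_fderiv_of_inner_eq_zero {W : Type*} [NormedAddCommGroup W]
    [InnerProductSpace ℝ W] {ν f : E → W} {p : E} (hν : DifferentiableAt ℝ ν p)
    (hf : ContDiffAt ℝ 2 f p)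
    (h : ∀ᶠ q in nhds p, ∀ u, (inner ℝ (ν q) (fderiv ℝ f q u) : ℝ) = 0) (u v : E) :
    (inner ℝ (fderiv ℝ ν p u) (fderiv ℝ f p v) : ℝ) =
      -inner ℝ (ν p) (fderiv ℝ (fderiv ℝ f) p u v) := by
  have hf' := differentiableAt_fderiv_of_contDiffAt hf
  have h0 : (fun q ↦ (inner ℝ (ν q) (fderiv ℝ f q v) : ℝ)) =ᶠ[nhds p] fun _ ↦ 0 :=
    h.mono fun q hq ↦ hq v
  have h1 := fderiv_inner_apply ℝ hν (hf'.clm_apply (differentiableAt_const v)) u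
  rw [h0.fderiv_eq, fderiv_clm_apply_apply hf' (differentiableAt_const v)] at h1
  simp only [fderiv_fun_const, Pi.zero_apply, zero_apply, map_zero, add_zero] at h1
  linarith

end SecondDerivatives

/-! ### Weingarten and Codazzi equations, and the differential of `σ` -/

section StructureEquations

variable {n : ℕ} {M : Type*} [TopologicalSpace M] [ChartedSpace (EuclideanSpace ℝ (Fin n)) M]
  [IsManifold (𝓡 n) ∞ M] [RiemannianBundle (fun x : M ↦ TangentSpace (𝓡 n) x)]
  {X N : M → EuclideanSpace ℝ (Fin (n + 1))}

/-- The shape operator as a continuous linear map. -/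
def shapeCLM (X N : M → EuclideanSpace ℝ (Fin (n + 1))) (x : M) :
    TangentSpace (𝓡 n) x →L[ℝ] TangentSpace (𝓡 n) x :=
  -(tangentialPart X x ∘L mvfderiv (𝓡 n) N x)

omit [IsManifold (𝓡 n) ∞ M] in
theorem tangentialPart_normal (hN : IsUnitNormal X N) (x : M) : tangentialPart X x (N x) = 0 :=
  adjoint_normal (hN.inner_mvfderiv x)

omit [IsManifold (𝓡 n) ∞ M] in
theorem inner_tangentialPart (x : M) (w : EuclideanSpace ℝ (Fin (n + 1)))
    (v : TangentSpace (𝓡 n) x) :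
    (inner ℝ (tangentialPart X x w) v : ℝ) = inner ℝ w (mvfderiv (𝓡 n) X x v) :=
  ContinuousLinearMap.adjoint_inner_left _ _ _

theorem inner_normal_mvfderiv_normal (hX : IsIsometricImmersion X) (hN : IsUnitNormal X N) (x : M)
    (v : TangentSpace (𝓡 n) x) : (inner ℝ (N x) (mvfderiv (𝓡 n) N x v) : ℝ) = 0 := by
  have h := mvfderiv_inner (mdifferentiableAt_normal hX hN x) (mdifferentiableAt_normal hX hN x) v
  have hc : (fun y ↦ (inner ℝ (N y) (N y) : ℝ)) = fun _ ↦ 1 := by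
    ext y
    rw [real_inner_self_eq_norm_sq, hN.norm_eq_one, one_pow]
  rw [hc, mvfderiv_const, real_inner_comm] at h
  simp only [zero_apply] at h
  rw [real_inner_comm]
  linarith

/-- Weingarten's equation. -/
theorem mvfderiv_normal (hX : IsIsometricImmersion X) (hN : IsUnitNormal X N) (x : M)
    (v : TangentSpace (𝓡 n) x) :
    mvfderiv (𝓡 n) N x v = -mvfderiv (𝓡 n) X x (shapeOperator X N x v) := by
  have h := tangent_add_normal hX hN x (mvfderiv (𝓡 n) N x v)
  rw [inner_normal_mvfderiv_normal hX hN, zero_smul, add_zero] at h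
  conv_lhs => rw [← h]
  change _ = -mvfderiv (𝓡 n) X x (-(tangentialPart X x (mvfderiv (𝓡 n) N x v)))
  rw [map_neg, neg_neg]

theorem weingarten_eq_conj (hX : IsIsometricImmersion X) (hN : IsUnitNormal X N) (x : M) :
    weingarten X N x = mvfderiv (𝓡 n) X x ∘L shapeCLM X N x ∘L (mvfderiv (𝓡 n) X x).adjoint := by
  ext1 w
  change -(mvfderiv (𝓡 n) N x (tangentialPart X x w)) = _
  rw [mvfderiv_normal hX hN, neg_neg]
  rfl

theorem weingarten_apply (hX : IsIsometricImmersion X) (hN : IsUnitNormal X N) (x : M)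
    (w : EuclideanSpace ℝ (Fin (n + 1))) :
    weingarten X N x w =
      mvfderiv (𝓡 n) X x (shapeOperator X N x (tangentialPart X x w)) := by
  rw [weingarten_eq_conj hX hN]
  rfl

omit [IsManifold (𝓡 n) ∞ M] in
theorem weingarten_mvfderiv (hX : IsIsometricImmersion X) (x : M) (v : TangentSpace (𝓡 n) x) :
    weingarten X N x (mvfderiv (𝓡 n) X x v) = -mvfderiv (𝓡 n) N x v := by
  change -(mvfderiv (𝓡 n) N x (tangentialPart X x _)) = _
  rw [hX.tangentialPart_mvfderiv]

omit [IsManifold (𝓡 n) ∞ M] in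
theorem weingarten_normal (hN : IsUnitNormal X N) (x : M) : weingarten X N x (N x) = 0 := by
  change -(mvfderiv (𝓡 n) N x (tangentialPart X x _)) = _
  rw [tangentialPart_normal hN, map_zero, neg_zero]

/-- In the chart, differentiating `⟨N, dX v⟩ = 0` gives `⟨A u, v⟩ = ⟨N, D²X(u, v)⟩`. -/
theorem isSymmetric_shapeOperator (hX : IsIsometricImmersion X) (hN : IsUnitNormal X N) (x : M) :
    (shapeOperator X N x).IsSymmetric := by
  have hpt := mem_extChartAt_target (I := 𝓡 n) x
  have hpx : (extChartAt (𝓡 n) x).symm (extChartAt (𝓡 n) x x) = x := extChartAt_to_inv x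
  have hG := (contDiffAt_comp_extChartAt_symm hX.contMDiff x hpt).of_le
    (show (2 : WithTop ℕ∞) ≤ ∞ by norm_cast)
  have key := inner_fderiv_fderiv_of_inner_eq_zero
    (differentiableAt_comp_symm (mdifferentiableAt_normal hX hN x)) hG (by
      filter_upwards [extChartAt_target_mem_nhds x] with q hq v
      exact inner_normal_fderiv_chart hX hN x hq v)
  simp only [Function.comp_apply, hpx] at key
  have hin (u v : TangentSpace (𝓡 n) x) : (inner ℝ (shapeOperator X N x u) v : ℝ) =
      inner ℝ (N x) (fderiv ℝ (fderiv ℝ (X ∘ (extChartAt (𝓡 n) x).symm))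
        (extChartAt (𝓡 n) x x) u v) := by
    change (inner ℝ (-(tangentialPart X x (mvfderiv (𝓡 n) N x u))) v : ℝ) = _
    rw [inner_neg_left, inner_tangentialPart,
      mvfderiv_eq_fderiv (mdifferentiableAt_normal hX hN x),
      mvfderiv_eq_fderiv (mdifferentiableAt_immersion hX x)]
    exact neg_eq_iff_eq_neg.2 (key u v)
  intro u v
  rw [real_inner_comm (shapeOperator X N x v), hin, hin]
  exact congrArg _ (fderiv_fderiv_comm hG u v)

theorem isSymmetric_weingarten (hX : IsIsometricImmersion X) (hN : IsUnitNormal X N) (x : M) :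
    (weingarten X N x : EuclideanSpace ℝ (Fin (n + 1)) →ₗ[ℝ] _).IsSymmetric := by
  intro u v
  simp only [ContinuousLinearMap.coe_coe]
  rw [weingarten_apply hX hN, weingarten_apply hX hN, ← inner_tangentialPart, real_inner_comm,
    ← inner_tangentialPart, real_inner_comm]
  exact isSymmetric_shapeOperator hX hN x _ _

theorem sigma_weingarten (hX : IsIsometricImmersion X) (hN : IsUnitNormal X N) (x : M) (k : ℕ) :
    sigma (weingarten X N x : EuclideanSpace ℝ (Fin (n + 1)) →ₗ[ℝ] _) k =
      sigma (shapeOperator X N x) k :=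
  sigma_eq_of_eq_conj (hX.inner_mvfderiv x) (weingarten_eq_conj hX hN x)
    (isSymmetric_shapeOperator hX hN x) (isSymmetric_weingarten hX hN x) k

omit [IsManifold (𝓡 n) ∞ M]
  [RiemannianBundle fun x : M ↦ TangentSpace (𝓡 n) x] in
theorem mvfderiv_clm_apply {F G : Type*} [NormedAddCommGroup F] [NormedSpace ℝ F]
    [NormedAddCommGroup G] [NormedSpace ℝ G] {B : M → F →L[ℝ] G} {Y : M → F} {x : M}
    (hB : MDifferentiableAt (𝓡 n) 𝓘(ℝ, F →L[ℝ] G) B x)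
    (hY : MDifferentiableAt (𝓡 n) 𝓘(ℝ, F) Y x) (v : TangentSpace (𝓡 n) x) :
    mvfderiv (𝓡 n) (fun y ↦ B y (Y y)) x v =
      mvfderiv (𝓡 n) B x v (Y x) + B x (mvfderiv (𝓡 n) Y x v) := by
  have hBY : MDifferentiableAt (𝓡 n) 𝓘(ℝ, G) (fun y ↦ B y (Y y)) x := hB.clm_apply hY
  rw [mvfderiv_eq_fderiv hBY, mvfderiv_eq_fderiv hB, mvfderiv_eq_fderiv hY]
  have h := fderiv_clm_apply_apply (differentiableAt_comp_symm hB) (differentiableAt_comp_symm hY) v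
  have h2 : (extChartAt (𝓡 n) x).symm (extChartAt (𝓡 n) x x) = x := extChartAt_to_inv x
  simp only [Function.comp_apply, h2] at h
  exact h

/-- Codazzi's equation. -/
theorem mvfderiv_weingarten_comm (hX : IsIsometricImmersion X) (hN : IsUnitNormal X N) (x : M)
    (v w : TangentSpace (𝓡 n) x) :
    mvfderiv (𝓡 n) (weingarten X N) x v (mvfderiv (𝓡 n) X x w) =
      mvfderiv (𝓡 n) (weingarten X N) x w (mvfderiv (𝓡 n) X x v) := by
  rw [mvfderiv_eq_fderiv (mdifferentiableAt_weingarten hX hN x),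
    mvfderiv_eq_fderiv (mdifferentiableAt_weingarten hX hN x),
    mvfderiv_eq_fderiv (mdifferentiableAt_immersion hX x),
    mvfderiv_eq_fderiv (mdifferentiableAt_immersion hX x)]
  have hpt := mem_extChartAt_target (I := 𝓡 n) x
  have h2 : (2 : WithTop ℕ∞) ≤ ∞ := by norm_cast
  refine fderiv_apply_comm_of_comp_fderiv_eq
    (differentiableAt_comp_symm (mdifferentiableAt_weingarten hX hN x))
    ((contDiffAt_comp_extChartAt_symm hX.contMDiff x hpt).of_le h2)
    ((contDiffAt_comp_extChartAt_symm (hN.contMDiff hX) x hpt).of_le h2) ?_ v w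
  filter_upwards [extChartAt_target_mem_nhds x] with q hq u
  obtain ⟨T, hT⟩ := exists_frame (F := EuclideanSpace ℝ (Fin (n + 1))) x hq
  rw [hT X (mdifferentiableAt_immersion hX _), hT N (mdifferentiableAt_normal hX hN _)]
  exact weingarten_mvfderiv hX _ _

/-- Differentiate `B N = 0`: `(D_v B)N = -B(D_v N) = B dX(A v)`. This is the source of the `A²` term
in the Hessian. -/
theorem mvfderiv_weingarten_normal (hX : IsIsometricImmersion X) (hN : IsUnitNormal X N) (x : M)
    (v : TangentSpace (𝓡 n) x) :
    mvfderiv (𝓡 n) (weingarten X N) x v (N x) =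
      mvfderiv (𝓡 n) X x (shapeOperator X N x (shapeOperator X N x v)) := by
  have h := mvfderiv_clm_apply (mdifferentiableAt_weingarten hX hN x)
    (mdifferentiableAt_normal hX hN x) v
  have h0 : (fun y ↦ weingarten X N y (N y)) = fun _ ↦ 0 := funext (weingarten_normal hN)
  rw [h0, mvfderiv_const, mvfderiv_normal hX hN, map_neg, weingarten_mvfderiv hX,
    mvfderiv_normal hX hN, neg_neg] at h
  rw [← sub_eq_zero, sub_eq_add_neg]
  exact h.symm

/-- The differential of `σ_{k+1}` is `v ↦ tr (P_k ∇_v A)`. -/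
theorem mvfderiv_sigma (hX : IsIsometricImmersion X) (hN : IsUnitNormal X N) (x : M) (k : ℕ)
    (hσ : MDifferentiableAt (𝓡 n) 𝓘(ℝ, ℝ)
      (fun y ↦ sigma (shapeOperator X N y) (k + 1)) x) (v : TangentSpace (𝓡 n) x) :
    mvfderiv (𝓡 n) (fun y ↦ sigma (shapeOperator X N y) (k + 1)) x v =
      LinearMap.trace ℝ (TangentSpace (𝓡 n) x) (newton (shapeOperator X N x) k *
        ((tangentialPart X x : _ →ₗ[ℝ] _) ∘ₗ
          (mvfderiv (𝓡 n) (weingarten X N) x v : EuclideanSpace ℝ (Fin (n + 1)) →L[ℝ]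
            EuclideanSpace ℝ (Fin (n + 1))).toLinearMap ∘ₗ
          (mvfderiv (𝓡 n) X x).toLinearMap)) := by
  have hC : (inner ℝ (N x) (mvfderiv (𝓡 n) (weingarten X N) x v (N x)) : ℝ) = 0 := by
    rw [mvfderiv_weingarten_normal hX hN, hN.inner_mvfderiv]
  refine Eq.trans ?_ (trace_newton_mul_of_eq_conj (hX.inner_mvfderiv x)
    (weingarten_eq_conj hX hN x) (isSymmetric_shapeOperator hX hN x)
    (isSymmetric_weingarten hX hN x) (hN.norm_eq_one x) (hN.inner_mvfderiv x)
    (finrank_tangentSpace_add_one x) _ hC k)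
  have hpx : (extChartAt (𝓡 n) x).symm (extChartAt (𝓡 n) x x) = x := extChartAt_to_inv x
  let v' : EuclideanSpace ℝ (Fin n) := v
  -- A straight line in the chart with velocity `v` reduces the claim to `hasDerivAt_sigma`. Its
  -- symmetry hypothesis holds for every parameter, even where the line leaves the chart, because
  -- `B` is symmetric at all points of `M`.
  let c : ℝ → EuclideanSpace ℝ (Fin n) := fun t ↦ extChartAt (𝓡 n) x x + t • v'
  have hc0 : c 0 = extChartAt (𝓡 n) x x := by simp only [c, zero_smul, add_zero]
  have hc : HasDerivAt c v' 0 := by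
    have h := ((hasDerivAt_id (0 : ℝ)).smul_const v').const_add (extChartAt (𝓡 n) x x)
    rwa [one_smul] at h
  have hB := differentiableAt_comp_symm (mdifferentiableAt_weingarten hX hN x)
  rw [← hc0] at hB
  have hB' := hB.hasFDerivAt.comp_hasDerivAt (0 : ℝ) hc
  have h1 := hasDerivAt_sigma hB' (fun s ↦ isSymmetric_weingarten hX hN _) k
  have hS := differentiableAt_comp_symm hσ
  rw [← hc0] at hS
  have h2 := hS.hasFDerivAt.comp_hasDerivAt (0 : ℝ) hc
  have h3 : (fun s ↦ sigma (((weingarten X N ∘ (extChartAt (𝓡 n) x).symm) ∘ c) s :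
      EuclideanSpace ℝ (Fin (n + 1)) →ₗ[ℝ] _) (k + 1)) =
      ((fun y ↦ sigma (shapeOperator X N y) (k + 1)) ∘ (extChartAt (𝓡 n) x).symm) ∘ c := by
    ext s
    exact sigma_weingarten hX hN _ _
  rw [h3] at h1
  have h4 := h2.unique h1
  rw [mvfderiv_eq_fderiv hσ, mvfderiv_eq_fderiv (mdifferentiableAt_weingarten hX hN x)]
  simp only [Function.comp_apply, hc0, hpx] at h4
  exact h4

end StructureEquations

/-! ### Gradient, Hessian and drifted operator of a square -/

section Gradient

theorem trace_comp_of_eq_smul_add {V : Type*} [NormedAddCommGroup V] [InnerProductSpace ℝ V]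
    [FiniteDimensional ℝ V] {P H H' : V →ₗ[ℝ] V} {a : ℝ} {g : V}
    (h : ∀ v, H' v = a • H v + (2 * inner ℝ g v : ℝ) • g) :
    LinearMap.trace ℝ V (P ∘ₗ H') = a * LinearMap.trace ℝ V (P ∘ₗ H) + 2 * inner ℝ (P g) g := by
  have e : P ∘ₗ H' = a • (P ∘ₗ H) + (2 : ℝ) • (innerₗ V g).smulRight (P g) := by
    ext v
    simp [h, smul_smul]
  rw [e, map_add, map_smul, map_smul, LinearMap.trace_smulRight, innerₗ_apply_apply,
    real_inner_comm g, smul_eq_mul, smul_eq_mul]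

variable {n : ℕ} {M : Type*} [TopologicalSpace M] [ChartedSpace (EuclideanSpace ℝ (Fin n)) M]
  [RiemannianBundle (fun x : M ↦ TangentSpace (𝓡 n) x)]
  {X N : M → EuclideanSpace ℝ (Fin (n + 1))}

theorem inner_grad (f : M → ℝ) (x : M) (v : TangentSpace (𝓡 n) x) :
    (inner ℝ (grad f x) v : ℝ) = mvfderiv (𝓡 n) f x v :=
  InnerProductSpace.toDual_symm_apply

theorem grad_sq {f : M → ℝ} {x : M} (hf : MDifferentiableAt (𝓡 n) 𝓘(ℝ, ℝ) f x) :
    grad (n := n) (fun y ↦ f y ^ 2) x = (2 * f x) • grad f x := by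
  refine ext_inner_right ℝ fun v ↦ ?_
  have h := mvfderiv_mul hf hf
  have h2 : (fun y ↦ f y ^ 2) = f * f := by
    ext y
    simp [sq]
  rw [real_inner_smul_left, inner_grad, inner_grad, h2, h]
  simp
  ring

theorem hess_apply (X : M → EuclideanSpace ℝ (Fin (n + 1))) (f : M → ℝ) (x : M)
    (v : TangentSpace (𝓡 n) x) :
    hess X f x v =
      tangentialPart X x (mvfderiv (𝓡 n) (fun y ↦ mvfderiv (𝓡 n) X y (grad f y)) x v) :=
  rfl

theorem hess_sq {f : M → ℝ} (hX : IsIsometricImmersion X)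
    (hf : MDifferentiable (𝓡 n) 𝓘(ℝ, ℝ) f) {x : M}
    (hg : MDifferentiableAt (𝓡 n) (𝓡 (n + 1)) (fun y ↦ mvfderiv (𝓡 n) X y (grad f y)) x)
    (v : TangentSpace (𝓡 n) x) :
    hess X (fun y ↦ f y ^ 2) x v =
      (2 * f x) • hess X f x v + (2 * inner ℝ (grad f x) v : ℝ) • grad f x := by
  have h1 : (fun y ↦ mvfderiv (𝓡 n) X y (grad (fun z ↦ f z ^ 2) y)) =
      (fun y ↦ 2 * f y) • fun y ↦ mvfderiv (𝓡 n) X y (grad f y) := by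
    ext1 y
    rw [grad_sq (hf y), map_smul]
    rfl
  have h2 : MDifferentiableAt (𝓡 n) 𝓘(ℝ, ℝ) (fun y ↦ 2 * f y) x := (hf x).const_smul (2 : ℝ)
  have h3 : mvfderiv (𝓡 n) (fun y ↦ 2 * f y) x v = 2 * mvfderiv (𝓡 n) f x v := by
    rw [mvfderiv_eq_fderiv h2, mvfderiv_eq_fderiv (hf x)]
    exact congrArg (fun T : EuclideanSpace ℝ (Fin n) →L[ℝ] ℝ ↦ T v)
      (fderiv_const_mul (differentiableAt_comp_symm (hf x)) 2)
  rw [hess_apply, h1, mvfderiv_smul h2 hg, hess_apply, inner_grad, ← h3]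
  simp [hX.tangentialPart_mvfderiv]

/-- The drift is a derivation, so only the rank-one part `2 df ⊗ ∇f` of `Hess f²` produces an extra
term. -/
theorem driftedL_sq {f : M → ℝ} (hX : IsIsometricImmersion X)
    (hf : MDifferentiable (𝓡 n) 𝓘(ℝ, ℝ) f) {x : M}
    (hg : MDifferentiableAt (𝓡 n) (𝓡 (n + 1)) (fun y ↦ mvfderiv (𝓡 n) X y (grad f y)) x) (k : ℕ) :
    1 / 2 * driftedL X N k (fun y ↦ f y ^ 2) x = f x * driftedL X N k f x +
      inner ℝ (newton (shapeOperator X N x) k (grad f x)) (grad f x) := by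
  rw [driftedL, driftedL, trace_comp_of_eq_smul_add (hess_sq hX hf hg), grad_sq (hf x), map_smul,
    real_inner_smul_right]
  ring

end Gradient

/-! ### The Hessian of `σ_r` on a self-shrinker -/

section SigmaOfSelfShrinker

variable {n r : ℕ} {M : Type*} [TopologicalSpace M] [ChartedSpace (EuclideanSpace ℝ (Fin n)) M]
  [IsManifold (𝓡 n) ∞ M] [RiemannianBundle (fun x : M ↦ TangentSpace (𝓡 n) x)]
  {X N : M → EuclideanSpace ℝ (Fin (n + 1))}

theorem contMDiff_sigma (hX : IsIsometricImmersion X) (hN : IsUnitNormal X N)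
    (hself : ∀ x, sigma (shapeOperator X N x) r = -inner ℝ (X x) (N x)) :
    ContMDiff (𝓡 n) 𝓘(ℝ, ℝ) ∞ fun x ↦ sigma (shapeOperator X N x) r := by
  have h : ContDiff ℝ ∞ fun p : EuclideanSpace ℝ (Fin (n + 1)) × EuclideanSpace ℝ (Fin (n + 1)) ↦
      -(inner ℝ p.1 p.2 : ℝ) := (contDiff_fst.inner ℝ contDiff_snd).neg
  simp only [hself]
  exact h.comp_contMDiff (hX.contMDiff.prodMk_space (hN.contMDiff hX))

/-- In `d⟨X, N⟩` the term `⟨dX v, N⟩` vanishes, leaving `dσ_r(v) = -⟨X, dN v⟩ = ⟨X^⊤, A v⟩`; then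
`A` is symmetric. -/
theorem grad_sigma (hX : IsIsometricImmersion X) (hN : IsUnitNormal X N)
    (hself : ∀ x, sigma (shapeOperator X N x) r = -inner ℝ (X x) (N x)) (x : M) :
    grad (fun y ↦ sigma (shapeOperator X N y) r) x =
      shapeOperator X N x (tangentialPart X x (X x)) := by
  refine ext_inner_right ℝ fun v ↦ ?_
  have h : (fun y ↦ sigma (shapeOperator X N y) r) = -fun y ↦ (inner ℝ (X y) (N y) : ℝ) :=
    funext hself
  rw [inner_grad, h, mvfderiv_neg, neg_apply, mvfderiv_inner (mdifferentiableAt_immersion hX x)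
    (mdifferentiableAt_normal hX hN x), mvfderiv_normal hX hN, inner_neg_right,
    real_inner_comm (N x), hN.inner_mvfderiv, add_zero, neg_neg, ← inner_tangentialPart,
    isSymmetric_shapeOperator hX hN x]

theorem mvfderiv_grad_sigma (hX : IsIsometricImmersion X) (hN : IsUnitNormal X N)
    (hself : ∀ x, sigma (shapeOperator X N x) r = -inner ℝ (X x) (N x)) (x : M) :
    mvfderiv (𝓡 n) X x (grad (fun y ↦ sigma (shapeOperator X N y) r) x) =
      weingarten X N x (X x) := by
  rw [grad_sigma hX hN hself, weingarten_apply hX hN]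

theorem hess_sigma (hX : IsIsometricImmersion X) (hN : IsUnitNormal X N)
    (hself : ∀ x, sigma (shapeOperator X N x) r = -inner ℝ (X x) (N x)) (x : M)
    (v : TangentSpace (𝓡 n) x) :
    hess X (fun y ↦ sigma (shapeOperator X N y) r) x v =
      tangentialPart X x (mvfderiv (𝓡 n) (weingarten X N) x (tangentialPart X x (X x))
        (mvfderiv (𝓡 n) X x v)) + shapeOperator X N x v -
        sigma (shapeOperator X N x) r • shapeOperator X N x (shapeOperator X N x v) := by
  -- Split `X = dX X^⊤ - σ_r N`: Codazzi exchanges `v` and `X^⊤` in the tangential term, and the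
  -- normal term gives `A²`.
  have h1 : mvfderiv (𝓡 n) (weingarten X N) x v (X x) =
      mvfderiv (𝓡 n) (weingarten X N) x (tangentialPart X x (X x)) (mvfderiv (𝓡 n) X x v) -
        sigma (shapeOperator X N x) r •
          mvfderiv (𝓡 n) X x (shapeOperator X N x (shapeOperator X N x v)) := by
    conv_lhs => rw [← tangent_add_normal hX hN x (X x)]
    rw [map_add, map_smul, mvfderiv_weingarten_comm hX hN, mvfderiv_weingarten_normal hX hN,
      hself, neg_smul, sub_neg_eq_add, real_inner_comm]
  rw [hess_apply]
  simp only [mvfderiv_grad_sigma hX hN hself]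
  rw [mvfderiv_clm_apply (mdifferentiableAt_weingarten hX hN x) (mdifferentiableAt_immersion hX x),
    h1, weingarten_apply hX hN, hX.tangentialPart_mvfderiv, map_add, map_sub, map_smul,
    hX.tangentialPart_mvfderiv, hX.tangentialPart_mvfderiv]
  abel

theorem driftedL_sigma (hX : IsIsometricImmersion X) (hN : IsUnitNormal X N) (k : ℕ)
    (hself : ∀ x, sigma (shapeOperator X N x) (k + 1) = -inner ℝ (X x) (N x)) (x : M) :
    driftedL X N k (fun y ↦ sigma (shapeOperator X N y) (k + 1)) x =
      (k + 1 - modifiedNormSq (shapeOperator X N x) k) * sigma (shapeOperator X N x) (k + 1) := by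
  set w := tangentialPart X x (X x)
  set A := shapeOperator X N x
  let C : TangentSpace (𝓡 n) x →ₗ[ℝ] TangentSpace (𝓡 n) x := (tangentialPart X x : _ →ₗ[ℝ] _) ∘ₗ
    (mvfderiv (𝓡 n) (weingarten X N) x w : EuclideanSpace ℝ (Fin (n + 1)) →L[ℝ]
      EuclideanSpace ℝ (Fin (n + 1))).toLinearMap ∘ₗ (mvfderiv (𝓡 n) X x).toLinearMap
  have hh : hess X (fun y ↦ sigma (shapeOperator X N y) (k + 1)) x =
      C + A - sigma A (k + 1) • (A ∘ₗ A) := by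
    ext1 v
    exact hess_sigma hX hN hself x v
  -- The drift equals `dσ_{k+1}(X^⊤) = tr (P_k C)`, exactly the trace of the `C` term of the
  -- Hessian, so the two cancel.
  have hd : (inner ℝ (X x) (mvfderiv (𝓡 n) X x
      (grad (fun y ↦ sigma (shapeOperator X N y) (k + 1)) x)) : ℝ) =
      LinearMap.trace ℝ (TangentSpace (𝓡 n) x) (newton A k * C) := by
    rw [← inner_tangentialPart, real_inner_comm, inner_grad]
    exact mvfderiv_sigma hX hN x k
      ((contMDiff_sigma hX hN hself).mdifferentiable (by norm_num) x) w
  have hA := trace_newton_mul (isSymmetric_shapeOperator hX hN x) k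
  have e : newton A k ∘ₗ (C + A - sigma A (k + 1) • (A ∘ₗ A)) =
      newton A k * C + newton A k * A - sigma A (k + 1) • (newton A k ∘ₗ A ∘ₗ A) := by
    rw [LinearMap.comp_sub, LinearMap.comp_add, LinearMap.comp_smul]
    rfl
  rw [driftedL, hd, hh, e, map_sub, map_add, map_smul, hA, modifiedNormSq, smul_eq_mul]
  ring

end SigmaOfSelfShrinker

end SelfShrinker

end

/-! ### The identities for `σ_r` and `σ_r²` -/

theorem proposition2p4 {n r : ℕ} (hr : 1 ≤ r) (hrn : r ≤ n)
    {M : Type*} [TopologicalSpace M] [ChartedSpace (EuclideanSpace ℝ (Fin n)) M]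
    [IsManifold (𝓡 n) ∞ M] [RiemannianBundle (fun x : M ↦ TangentSpace (𝓡 n) x)]
    (X N : M → EuclideanSpace ℝ (Fin (n + 1)))
    (hX : SelfShrinker.IsIsometricImmersion X) (hN : SelfShrinker.IsUnitNormal X N)
    (hself : ∀ x, SelfShrinker.sigma (SelfShrinker.shapeOperator X N x) r = -inner ℝ (X x) (N x)) :
    let A := SelfShrinker.shapeOperator X N
    let P := fun x ↦ SelfShrinker.newton (A x) (r - 1)
    let σ : M → ℝ := fun x ↦ SelfShrinker.sigma (A x) r
    let L := SelfShrinker.driftedL X N (r - 1)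
    let normSq : M → ℝ := fun x ↦ SelfShrinker.modifiedNormSq (A x) (r - 1)
    -- the objects below are classical: `N` and `σ_r` are smooth
    (ContMDiff (𝓡 n) (𝓡 (n + 1)) ∞ N ∧ ContMDiff (𝓡 n) 𝓘(ℝ, ℝ) ∞ σ) ∧
    -- where `P_{r-1} ≥ 0`, it has a unique square root `√P_{r-1}`, and `normSq = ‖√P_{r-1} A‖²`
    (∀ x, (P x).IsPositive → ∃! S, SelfShrinker.IsSqrt S (P x)) ∧
    (∀ x S, SelfShrinker.IsSqrt S (P x) → SelfShrinker.traceNormSq (S ∘ₗ A x) = normSq x) ∧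
    (∀ x, L σ x + (normSq x - r) * σ x = 0) ∧
    (∀ x, 1 / 2 * L (fun y ↦ σ y ^ 2) x =
      σ x ^ 2 * (r - normSq x) +
        inner ℝ (P x (SelfShrinker.grad σ x)) (SelfShrinker.grad σ x)) ∧
    (∀ x, (P x).IsPositive → normSq x ≤ r → 0 ≤ 1 / 2 * L (fun y ↦ σ y ^ 2) x) := by
  obtain ⟨k, rfl⟩ : ∃ k, r = k + 1 := ⟨r - 1, by omega⟩
  intro A P σ L normSq
  have hσ : ContMDiff (𝓡 n) 𝓘(ℝ, ℝ) ∞ σ := SelfShrinker.contMDiff_sigma hX hN hself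
  have hL (x : M) : L σ x = (((k + 1 : ℕ) : ℝ) - normSq x) * σ x := by
    push_cast
    exact SelfShrinker.driftedL_sigma hX hN k hself x
  have hsq (x : M) : 1 / 2 * L (fun y ↦ σ y ^ 2) x = σ x ^ 2 * (((k + 1 : ℕ) : ℝ) - normSq x) +
      inner ℝ (P x (SelfShrinker.grad σ x)) (SelfShrinker.grad σ x) := by
    -- The Hessian of `σ²` needs a differentiable gradient field; here its image under `dX` is `B
    -- X`, a product of differentiable maps.
    have hg : MDifferentiableAt (𝓡 n) (𝓡 (n + 1))
        (fun y ↦ mvfderiv (𝓡 n) X y (SelfShrinker.grad σ y)) x := by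
      have e : (fun y ↦ mvfderiv (𝓡 n) X y (SelfShrinker.grad σ y)) =
          fun y ↦ SelfShrinker.weingarten X N y (X y) :=
        funext (SelfShrinker.mvfderiv_grad_sigma hX hN hself)
      rw [e]
      exact (SelfShrinker.mdifferentiableAt_weingarten hX hN x).clm_apply
        (SelfShrinker.mdifferentiableAt_immersion hX x)
    rw [SelfShrinker.driftedL_sq hX (hσ.mdifferentiable (by norm_num)) hg]
    have h := hL x
    linear_combination σ x * h
  refine ⟨⟨hN.contMDiff hX, hσ⟩, fun x hP ↦ ?_, fun x S hS ↦ ?_, fun x ↦ ?_, hsq,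
    fun x hP hle ↦ ?_⟩
  · obtain ⟨S, hS⟩ := SelfShrinker.exists_isSqrt hP
    exact ⟨S, hS, fun T hT ↦ hT.unique hS⟩
  · exact SelfShrinker.traceNormSq_comp hS (SelfShrinker.isSymmetric_shapeOperator hX hN x)
  · rw [hL]
    ring
  · rw [hsq]
    exact add_nonneg (mul_nonneg (sq_nonneg _) (sub_nonneg.2 hle)) (hP.inner_nonneg_left _)
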